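/- Let $N\in\mathbb N$ and $[N]=\{1,\dots,N\}$. Let $\mathcal T_{N,\mathrm{free}}$ be the graph whose vertices are the alternating strings on the alphabet $[N]$ (finite strings, possibly empty, in which consecutive letters are distinct) and whose edges are $s\sim js$ for each letter $j$ and each alternating string $s$ not beginning with $j$. Let $\mathrm{Tree}(N)$ be the set of connected subgraphs $\mathcal T$ of $\mathcal T_{N,\mathrm{free}}$ containing the empty string $\emptyset$, each identified with its set of vertices, with the metric $\rho_N(\mathcal T,\mathcal T')=\exp(-\sup\{\ell\ge 0: B_\ell(\mathcal T)=B_\ell(\mathcal T')\})$, where $B_\ell(\mathcal T)$ is the set of strings in $\mathcal T$ of length at most $\ell$ (and $\exp(-\infty)=0$). For $j\in[N]\cap\mathcal T$ (that is, the one-letter string $j$ belongs to $\mathcal T$) let $\mathrm{br}_j(\mathcal T)=\{s\in\mathcal T_{N,\mathrm{free}}: sj\in\mathcal T\}\in\mathrm{Tree}(N)$. Let $\mathcal P(\mathbb R)$ be the set of Borel probability measures on $\mathbb R$ with the topology of weak convergence (which coincides on $\mathcal P(\mathbb R)$ with the vague topology), and for $\mu\in\mathcal P(\mathbb R)$ and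 $\operatorname{Im} z>0$ let $$G_\mu(z)=\int_{\mathbb R}\frac{d\mu(t)}{z-t},\qquad F_\mu(z)=\frac1{G_\mu(z)},\qquad K_\mu(z)=z-F_\mu(z).$$ **Theorem.** There exists a unique function $$\mathrm{Tree}(N)\times\mathcal P(\mathbb R)^N\to\mathcal P(\mathbb R),\qquad (\mathcal T,\mu_1,\dots,\mu_N)\mapsto\boxplus_{\mathcal T}(\mu_1,\dots,\mu_N),$$ that is continuous in $\mathcal T$ for each fixed $(\mu_1,\dots,\mu_N)$ and satisfies, for all $\mathcal T\in\mathrm{Tree}(N)$, all $\mu_1,\dots,\mu_N\in\mathcal P(\mathbb R)$ and all $z$ with $\operatorname{Im}z>0$, $$K_{\boxplus_{\mathcal T}(\mu_1,\dots,\mu_N)}(z)=\sum_{j\in[N]\cap\mathcal T}K_{\mu_j}\bigl(z-K_{\boxplus_{\mathrm{br}_j(\mathcal T)}(\mu_1,\dots,\mu_N)}(z)\bigr).$$ Moreover, this function is jointly continuous on $\mathrm{Tree}(N)\times\mathcal P(\mathbb R)^N$. -/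

import Mathlib

open MeasureTheory

namespace TreeConvolution

/-! ### Cauchy, `F`- and `K`-transforms -/

/-- The Cauchy-Stieltjes transform `G_μ(z) = ∫ 1 / (z - t) dμ(t)`. -/
noncomputable def cauchyTransform (μ : ProbabilityMeasure ℝ) (z : ℂ) : ℂ :=
  ∫ t : ℝ, 1 / (z - (t : ℂ)) ∂(μ : Measure ℝ)

/-- The `F`-transform `F_μ(z) = 1 / G_μ(z)`. -/
noncomputable def fTransform (μ : ProbabilityMeasure ℝ) (z : ℂ) : ℂ :=
  1 / cauchyTransform μ z

/-- The `K`-transform `K_μ(z) = z - F_μ(z)`. -/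
noncomputable def kTransform (μ : ProbabilityMeasure ℝ) (z : ℂ) : ℂ :=
  z - fTransform μ z

/-! ### Alternating strings and rooted subtrees -/

/-- Alternating strings on the alphabet `[N]`: consecutive letters are distinct. -/
def AltString (N : ℕ) : Type :=
  {s : List (Fin N) // s.IsChain (fun i j => i ≠ j)}

/-- The empty string. -/
def AltString.empty (N : ℕ) : AltString N := ⟨[], by simp⟩

/-- The string consisting of the single letter `j`. -/
def AltString.letter {N : ℕ} (j : Fin N) : AltString N := ⟨[j], by simp⟩

/-- The graph `T_{N,free}` on the alternating strings, whose edges are `s ∼ js`, where `js` is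
obtained by appending the letter `j` to the left of `s` (`js` alternating). -/
def freeTree (N : ℕ) : SimpleGraph (AltString N) where
  Adj s t := ∃ j : Fin N, t.1 = j :: s.1 ∨ s.1 = j :: t.1
  symm := ⟨fun _ _ ⟨j, h⟩ => ⟨j, h.symm⟩⟩
  loopless := ⟨fun s ⟨j, h⟩ => by
    rcases h with h | h <;> simpa using congrArg List.length h⟩

/-- `Tree(N)`: the rooted subtrees of `T_{N,free}`, that is, the connected subgraphs containing the
empty string. As `T_{N,free}` is a tree, a connected subgraph is determined by its vertex
set and is the subgraph induced on it, so it is recorded by its vertices. -/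
@[ext]
structure RootedTree (N : ℕ) where
  verts : Set (AltString N)
  root_mem : AltString.empty N ∈ verts
  connected : ((freeTree N).induce verts).Connected

/-- A set of alternating strings containing the root is connected as soon as it contains the parent
of each of its elements. -/
theorem connected_of_parent {N : ℕ} {V : Set (AltString N)} (h0 : AltString.empty N ∈ V)
    (hp : ∀ (j : Fin N) (s t : AltString N), t ∈ V → t.1 = j :: s.1 → s ∈ V) :
    ((freeTree N).induce V).Connected := by
  have key : ∀ (l : List (Fin N)) (hl : l.IsChain (fun i j => i ≠ j))
      (hV : (⟨l, hl⟩ : AltString N) ∈ V),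
      ((freeTree N).induce V).Reachable ⟨⟨l, hl⟩, hV⟩ ⟨AltString.empty N, h0⟩ := by
    intro l
    induction l with
    | nil => intro hl hV; exact SimpleGraph.Reachable.refl _
    | cons j l ih =>
      intro hl hV
      have hl' : l.IsChain (fun i j => i ≠ j) := hl.tail
      have hV' : (⟨l, hl'⟩ : AltString N) ∈ V := hp j ⟨l, hl'⟩ _ hV rfl
      refine SimpleGraph.Reachable.trans (SimpleGraph.Adj.reachable ?_) (ih hl' hV')
      exact ⟨j, Or.inr rfl⟩
  have : Nonempty V := ⟨⟨_, h0⟩⟩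
  refine SimpleGraph.Connected.mk fun u v => ?_
  exact (key u.1.1 u.1.2 u.2).trans (key v.1.1 v.1.2 v.2).symm

/-- A rooted subtree contains the parent of each of its vertices. -/
theorem RootedTree.parent_mem {N : ℕ} (T : RootedTree N) (j : Fin N) (s t : AltString N)
    (ht : t ∈ T.verts) (hts : t.1 = j :: s.1) : s ∈ T.verts := by
  obtain ⟨p⟩ := T.connected.preconnected ⟨t, ht⟩ ⟨AltString.empty N, T.root_mem⟩
  obtain ⟨d, -, h1, h2⟩ := p.exists_boundary_dart {u | t.1 <:+ u.1.1}
    (List.suffix_refl _) (by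
      intro h
      have h' : t.1 = [] := List.suffix_nil.1 h
      simp [hts] at h')
  have hadj : (freeTree N).Adj d.fst.1 d.snd.1 := d.adj
  obtain ⟨i, h | h⟩ := hadj
  · exact absurd (show t.1 <:+ d.snd.1.1 from
      h ▸ List.IsSuffix.trans h1 (List.suffix_cons i _)) h2
  · have h1' : t.1 <:+ i :: d.snd.1.1 := h ▸ h1
    rcases List.suffix_cons_iff.1 h1' with h3 | h3
    · have h4 : s = d.snd.1 := Subtype.ext (List.cons.inj (hts.symm.trans h3)).2
      exact h4 ▸ d.snd.2
    · exact absurd h3 h2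

/-- The branch `br_j(T) = {s : sj ∈ T}` for a letter `j ∈ T`. -/
def RootedTree.branch {N : ℕ} (T : RootedTree N) (j : Fin N)
    (hj : AltString.letter j ∈ T.verts) : RootedTree N where
  verts := {s | ∃ t ∈ T.verts, t.1 = s.1 ++ [j]}
  root_mem := ⟨_, hj, rfl⟩
  connected := connected_of_parent ⟨_, hj, rfl⟩ (by
    rintro i s t ⟨u, hu, hut⟩ hts
    have h1 : u.1 = i :: (s.1 ++ [j]) := by rw [hut, hts]; rfl
    have h2 : (s.1 ++ [j]).IsChain (fun i j => i ≠ j) := (h1 ▸ u.2).tail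
    exact ⟨⟨_, h2⟩, T.parent_mem i ⟨_, h2⟩ u hu h1, rfl⟩)

/-! ### The metric on `Tree(N)` -/

/-- `B_ℓ(T)`: the strings in `T` of length at most `ℓ`. -/
def RootedTree.ball {N : ℕ} (T : RootedTree N) (l : ℕ) : Set (AltString N) :=
  {s | s ∈ T.verts ∧ s.1.length ≤ l}

open Classical in
/-- `ρ_N(T, T') = exp (- sup {ℓ : B_ℓ(T) = B_ℓ(T')})`. The supremum is infinite exactly when
`T = T'`, and then the distance is `0`. -/
noncomputable def RootedTree.rho {N : ℕ} (T T' : RootedTree N) : ℝ :=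
  if T = T' then 0 else Real.exp (-((sSup {l : ℕ | T.ball l = T'.ball l} : ℕ) : ℝ))

theorem RootedTree.ball_zero {N : ℕ} (T : RootedTree N) : T.ball 0 = {AltString.empty N} := by
  ext s
  constructor
  · rintro ⟨-, h⟩
    exact Subtype.ext (List.length_eq_zero_iff.1 (Nat.le_zero.1 h))
  · rintro rfl
    exact ⟨T.root_mem, le_rfl⟩

theorem RootedTree.ball_eq_of_le {N : ℕ} {T T' : RootedTree N} {k l : ℕ} (hkl : k ≤ l)
    (h : T.ball l = T'.ball l) : T.ball k = T'.ball k := by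
  ext s
  have h1 := Set.ext_iff.1 h s
  simp only [RootedTree.ball, Set.mem_ofPred_eq] at h1 ⊢
  constructor
  · rintro ⟨h2, h3⟩
    exact ⟨(h1.1 ⟨h2, h3.trans hkl⟩).1, h3⟩
  · rintro ⟨h2, h3⟩
    exact ⟨(h1.2 ⟨h2, h3.trans hkl⟩).1, h3⟩

theorem RootedTree.bddAbove_of_ne {N : ℕ} {T T' : RootedTree N} (h : T ≠ T') :
    BddAbove {l : ℕ | T.ball l = T'.ball l} := by
  by_contra hb
  apply h
  rw [not_bddAbove_iff] at hb
  refine RootedTree.ext (Set.ext fun s => ?_)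
  obtain ⟨l, hl, hsl⟩ := hb s.1.length
  have h1 := Set.ext_iff.1 (show T.ball l = T'.ball l from hl) s
  simp only [RootedTree.ball, Set.mem_ofPred_eq] at h1
  exact ⟨fun h2 => (h1.1 ⟨h2, hsl.le⟩).1, fun h2 => (h1.2 ⟨h2, hsl.le⟩).1⟩

theorem RootedTree.ball_sSup {N : ℕ} {T T' : RootedTree N} (h : T ≠ T') :
    T.ball (sSup {l : ℕ | T.ball l = T'.ball l}) =
      T'.ball (sSup {l : ℕ | T.ball l = T'.ball l}) :=
  Nat.sSup_mem (s := {l : ℕ | T.ball l = T'.ball l})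
    ⟨0, by simp [RootedTree.ball_zero]⟩ (RootedTree.bddAbove_of_ne h)

theorem RootedTree.rho_self {N : ℕ} (T : RootedTree N) : T.rho T = 0 := by simp [RootedTree.rho]

theorem RootedTree.rho_nonneg {N : ℕ} (T T' : RootedTree N) : 0 ≤ T.rho T' := by
  unfold RootedTree.rho
  split_ifs
  · exact le_rfl
  · exact (Real.exp_pos _).le

theorem RootedTree.rho_comm {N : ℕ} (T T' : RootedTree N) : T.rho T' = T'.rho T := by
  unfold RootedTree.rho
  by_cases h : T = T'
  · simp [h]
  · have h1 : {l : ℕ | T.ball l = T'.ball l} = {l : ℕ | T'.ball l = T.ball l} :=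
      Set.ext fun _ => ⟨Eq.symm, Eq.symm⟩
    rw [if_neg h, if_neg (Ne.symm h), h1]

theorem RootedTree.rho_le_max {N : ℕ} (T T' T'' : RootedTree N) :
    T.rho T'' ≤ max (T.rho T') (T'.rho T'') := by
  by_cases h : T = T'
  · subst h; exact le_max_right _ _
  by_cases h' : T' = T''
  · subst h'; exact le_max_left _ _
  by_cases h'' : T = T''
  · subst h''; rw [RootedTree.rho_self]; exact le_max_of_le_left (RootedTree.rho_nonneg _ _)
  have key : min (sSup {l : ℕ | T.ball l = T'.ball l}) (sSup {l : ℕ | T'.ball l = T''.ball l}) ≤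
      sSup {l : ℕ | T.ball l = T''.ball l} :=
    le_csSup (RootedTree.bddAbove_of_ne h'')
      ((RootedTree.ball_eq_of_le (min_le_left _ _) (RootedTree.ball_sSup h)).trans
        (RootedTree.ball_eq_of_le (min_le_right _ _) (RootedTree.ball_sSup h')))
  simp only [RootedTree.rho, if_neg h, if_neg h', if_neg h'']
  rcases min_le_iff.1 key with h1 | h1
  · exact le_max_of_le_left (Real.exp_le_exp.2 (neg_le_neg (Nat.cast_le.2 h1)))
  · exact le_max_of_le_right (Real.exp_le_exp.2 (neg_le_neg (Nat.cast_le.2 h1)))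

/-- `Tree(N)` with the metric `ρ_N`; its topology is the one defined by this metric. -/
noncomputable instance {N : ℕ} : MetricSpace (RootedTree N) where
  dist := RootedTree.rho
  dist_self := RootedTree.rho_self
  dist_comm := RootedTree.rho_comm
  dist_triangle T T' T'' := (RootedTree.rho_le_max T T' T'').trans
    (max_le_add_of_nonneg (RootedTree.rho_nonneg _ _) (RootedTree.rho_nonneg _ _))
  eq_of_dist_eq_zero {T T'} h := by
    by_contra hne
    have h1 : T.rho T' = 0 := h
    rw [RootedTree.rho, if_neg hne] at h1
    exact (Real.exp_pos _).ne' h1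

/-! ### The fixed-point equation -/

open Classical in
/-- The fixed-point equation on the upper half-plane,
`K_{C(T, μ)}(z) = ∑_{j ∈ [N] ∩ T} K_{μ_j}(z - K_{C(br_j(T), μ)}(z))`,
for all `T`, `μ = (μ_1, …, μ_N)` and `z`. -/
def SatisfiesFixedPointEquation {N : ℕ}
    (C : RootedTree N → (Fin N → ProbabilityMeasure ℝ) → ProbabilityMeasure ℝ) : Prop :=
  ∀ (T : RootedTree N) (μ : Fin N → ProbabilityMeasure ℝ) (z : ℂ), 0 < z.im →
    kTransform (C T μ) z =
      ∑ j : {j : Fin N // AltString.letter j ∈ T.verts},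
        kTransform (μ j.1) (z - kTransform (C (T.branch j.1 j.2) μ) z)

end TreeConvolution

namespace TreeConvolution

open Filter Topology BoundedContinuousFunction Complex

/-! ### Resolvent functions and elementary properties of the transforms -/

/-! Since `Im F(z) ≥ Im z` (`im_le_im_fTransform`), `z - K(z)` stays in the upper half-plane, and
the equation expresses `K` for a tree through `K` for its branches. Cut at height `l`, this is a
finite recursion starting from `K = 0`; the solution is its limit as `l → ∞`. Two points carry the
existence proof.

The right-hand side must be the `K`-transform of a probability measure (`exists_kTransform_eq_sum`).
For finitely supported measures, a Schur complement shows that `K` is a real constant plus the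
Cauchy transform of a finitely supported positive measure. Conversely, for such a function `k`, `1 /
(z - k)` is the corner entry of the resolvent of a bordered Hermitian matrix, hence a Cauchy
transform. This class is therefore stable under sums and under substitution of `z - K_ν(z)`.
Arbitrary measures follow by approximation and compactness.

The recursion must converge at a rate independent of the tree. With `τ(y) = ∫ min(1, |t|/y) dμ`,
which tends to `0`, `K_μ` is bounded by `12yτ` and is `136τ`-Lipschitz on the disc `|w - iy| ≤ y/2`
once `τ ≤ 1/8`. So for large `y` the recursion at `iy` stays in the disc and contracts by `1/2`
(`dist_kTransform_truncConv_succ_le`). Values of `G` far up the imaginary axis already detect weak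
convergence (`tendsto_of_tendsto_cauchyTransform`), so no other points need estimates.

Joint continuity holds because a truncated convolution depends only on a ball of the tree and its
`K`-transform is continuous in the measures, while the geometric error is uniform over all trees and
near a given tuple of measures. For uniqueness, the equation determines the values on trees of
bounded height by induction, and such trees are dense. -/

lemma sub_ofReal_ne_zero {z : ℂ} (hz : z.im ≠ 0) (t : ℝ) : z - t ≠ 0 := by
  intro h
  apply hz
  simpa using congrArg Complex.im h

lemma abs_im_le_norm_sub_ofReal (z : ℂ) (t : ℝ) : |z.im| ≤ ‖z - t‖ := by
  simpa using Complex.abs_im_le_norm (z - t)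

lemma norm_one_div_sub_le {z : ℂ} (hz : z.im ≠ 0) (t : ℝ) : ‖1 / (z - t)‖ ≤ 1 / |z.im| := by
  rw [norm_div, norm_one]
  exact one_div_le_one_div_of_le (abs_pos.2 hz) (abs_im_le_norm_sub_ofReal z t)

/-- The function `t ↦ 1 / (z - t)` on the real line. -/
noncomputable def resolventFun (z : ℂ) (hz : z.im ≠ 0) : ℝ →ᵇ ℂ :=
  BoundedContinuousFunction.ofNormedAddCommGroup (fun t : ℝ => 1 / (z - t))
    (by
      refine continuous_const.div (by fun_prop) fun t => sub_ofReal_ne_zero hz t)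
    (1 / |z.im|) (norm_one_div_sub_le hz)

@[simp] lemma resolventFun_apply (z : ℂ) (hz : z.im ≠ 0) (t : ℝ) :
    resolventFun z hz t = 1 / (z - t) := rfl

lemma integrable_resolvent (μ : ProbabilityMeasure ℝ) {z : ℂ} (hz : z.im ≠ 0) :
    Integrable (fun t : ℝ => 1 / (z - (t : ℂ))) (μ : Measure ℝ) :=
  (resolventFun z hz).integrable (μ : Measure ℝ)

lemma im_resolvent (z : ℂ) (t : ℝ) : (1 / (z - (t : ℂ))).im = -z.im * ‖1 / (z - (t : ℂ))‖ ^ 2 := by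
  rw [one_div, Complex.inv_im, norm_inv, inv_pow, ← Complex.normSq_eq_norm_sq]
  simp [div_eq_mul_inv]

lemma integrable_norm_sq_resolvent (μ : ProbabilityMeasure ℝ) {z : ℂ} (hz : z.im ≠ 0) :
    Integrable (fun t : ℝ => ‖1 / (z - (t : ℂ))‖ ^ 2) (μ : Measure ℝ) := by
  have h := (integrable_resolvent μ hz).im.const_mul (-z.im)⁻¹
  refine h.congr (Eventually.of_forall fun t => ?_)
  simp only [RCLike.im_to_complex, im_resolvent]
  field_simp

lemma cauchyTransform_im (μ : ProbabilityMeasure ℝ) {z : ℂ} (hz : z.im ≠ 0) :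
    (cauchyTransform μ z).im = -z.im * ∫ t : ℝ, ‖1 / (z - (t : ℂ))‖ ^ 2 ∂(μ : Measure ℝ) := by
  have h := integral_im (integrable_resolvent μ hz)
  simp only [RCLike.im_to_complex] at h
  rw [cauchyTransform, ← h, ← integral_const_mul]
  simp only [im_resolvent]

/-- Jensen's inequality, obtained from the nonnegativity of the variance of `‖1 / (z - t)‖`. -/
lemma norm_sq_cauchyTransform_le (μ : ProbabilityMeasure ℝ) {z : ℂ} (hz : z.im ≠ 0) :
    ‖cauchyTransform μ z‖ ^ 2 ≤ ∫ t : ℝ, ‖1 / (z - (t : ℂ))‖ ^ 2 ∂(μ : Measure ℝ) := by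
  have h1 : ‖cauchyTransform μ z‖ ≤ ∫ t : ℝ, ‖1 / (z - (t : ℂ))‖ ∂(μ : Measure ℝ) :=
    norm_integral_le_integral_norm _
  have hi := (integrable_resolvent μ hz).norm
  set c := ∫ t : ℝ, ‖1 / (z - (t : ℂ))‖ ∂(μ : Measure ℝ) with hc
  have h2 : 0 ≤ ∫ t : ℝ, (‖1 / (z - (t : ℂ))‖ - c) ^ 2 ∂(μ : Measure ℝ) :=
    integral_nonneg fun _ => sq_nonneg _
  have h3 : ∫ t : ℝ, (‖1 / (z - (t : ℂ))‖ - c) ^ 2 ∂(μ : Measure ℝ) =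
      (∫ t : ℝ, ‖1 / (z - (t : ℂ))‖ ^ 2 ∂(μ : Measure ℝ)) - 2 * c * c + c ^ 2 := by
    have : (fun t : ℝ => (‖1 / (z - (t : ℂ))‖ - c) ^ 2) =
        fun t : ℝ => (‖1 / (z - (t : ℂ))‖ ^ 2 - 2 * c * ‖1 / (z - (t : ℂ))‖) + c ^ 2 := by
      ext t; ring
    have hi2 : Integrable (fun t : ℝ => ‖1 / (z - (t : ℂ))‖ ^ 2 - 2 * c * ‖1 / (z - (t : ℂ))‖)
        (μ : Measure ℝ) := (integrable_norm_sq_resolvent μ hz).sub (hi.const_mul _)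
    rw [this, integral_add hi2 (integrable_const _), integral_sub (integrable_norm_sq_resolvent μ hz) (hi.const_mul _),
      integral_const_mul, ← hc]
    simp
  have h4 : ‖cauchyTransform μ z‖ ^ 2 ≤ c ^ 2 := pow_le_pow_left₀ (norm_nonneg _) h1 2
  nlinarith

lemma integral_norm_sq_resolvent_pos (μ : ProbabilityMeasure ℝ) {z : ℂ} (hz : z.im ≠ 0) :
    0 < ∫ t : ℝ, ‖1 / (z - (t : ℂ))‖ ^ 2 ∂(μ : Measure ℝ) := by
  rw [integral_pos_iff_support_of_nonneg (fun _ => sq_nonneg _) (integrable_norm_sq_resolvent μ hz)]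
  have : (Function.support fun t : ℝ => ‖1 / (z - (t : ℂ))‖ ^ 2) = Set.univ := by
    refine Set.eq_univ_of_forall fun t => ?_
    simp [sub_ofReal_ne_zero hz t]
  rw [this]
  simp

lemma cauchyTransform_ne_zero (μ : ProbabilityMeasure ℝ) {z : ℂ} (hz : z.im ≠ 0) :
    cauchyTransform μ z ≠ 0 := by
  intro h
  have h1 := cauchyTransform_im μ hz
  rw [h, Complex.zero_im] at h1
  exact mul_ne_zero (neg_ne_zero.2 hz) (integral_norm_sq_resolvent_pos μ hz).ne' h1.symm

/-- Here `Im F = -Im G / |G|² = Im z · ∫ |1/(z - t)|² / |G|²`, and the quotient is at least `1` by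
`norm_sq_cauchyTransform_le`. This is what keeps all the compositions in the upper half-plane. -/
lemma im_le_im_fTransform (μ : ProbabilityMeasure ℝ) {z : ℂ} (hz : 0 < z.im) :
    z.im ≤ (fTransform μ z).im := by
  have h0 := cauchyTransform_ne_zero μ hz.ne'
  rw [fTransform, one_div, Complex.inv_im, cauchyTransform_im μ hz.ne', Complex.normSq_eq_norm_sq,
    le_div_iff₀ (by positivity)]
  nlinarith [norm_sq_cauchyTransform_le μ hz.ne']

lemma sub_kTransform (μ : ProbabilityMeasure ℝ) (z : ℂ) : z - kTransform μ z = fTransform μ z := by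
  rw [kTransform, sub_sub_cancel]

lemma im_le_im_sub_kTransform (μ : ProbabilityMeasure ℝ) {z : ℂ} (hz : 0 < z.im) :
    z.im ≤ (z - kTransform μ z).im := by
  rw [sub_kTransform]
  exact im_le_im_fTransform μ hz

lemma im_sub_kTransform_pos (μ : ProbabilityMeasure ℝ) {z : ℂ} (hz : 0 < z.im) :
    0 < (z - kTransform μ z).im :=
  hz.trans_le (im_le_im_sub_kTransform μ hz)

lemma cauchyTransform_eq_one_div (μ : ProbabilityMeasure ℝ) (z : ℂ) :
    cauchyTransform μ z = 1 / (z - kTransform μ z) := by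
  rw [sub_kTransform, fTransform, one_div_one_div]

lemma kTransform_eq_of_cauchyTransform_eq {μ : ProbabilityMeasure ℝ} {z k : ℂ}
    (h : cauchyTransform μ z = 1 / (z - k)) : kTransform μ z = k := by
  rw [kTransform, fTransform, h, one_div_one_div, sub_sub_cancel]

/-! ### Continuity of the transforms -/

lemma norm_cauchyTransform_sub_le (μ : ProbabilityMeasure ℝ) {z w : ℂ} (hz : z.im ≠ 0)
    (hw : w.im ≠ 0) :
    ‖cauchyTransform μ z - cauchyTransform μ w‖ ≤ ‖z - w‖ * (1 / |z.im| * (1 / |w.im|)) := by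
  rw [cauchyTransform, cauchyTransform,
    ← integral_sub (integrable_resolvent μ hz) (integrable_resolvent μ hw)]
  refine (norm_integral_le_of_norm_le_const (C := ‖z - w‖ * (1 / |z.im| * (1 / |w.im|)))
    (Eventually.of_forall fun t => ?_)).trans (by simp)
  have h1 := sub_ofReal_ne_zero hz t
  have h2 := sub_ofReal_ne_zero hw t
  have : 1 / (z - (t : ℂ)) - 1 / (w - (t : ℂ)) =
      (w - z) * (1 / (z - (t : ℂ)) * (1 / (w - (t : ℂ)))) := by
    field_simp
    ring
  rw [this, norm_mul, norm_mul, norm_sub_rev]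
  gcongr
  · exact norm_one_div_sub_le hz t
  · exact norm_one_div_sub_le hw t

lemma tendsto_cauchyTransform_left {ι : Type*} {l : Filter ι} {μ : ι → ProbabilityMeasure ℝ}
    {μ₀ : ProbabilityMeasure ℝ} (h : Tendsto μ l (𝓝 μ₀)) {z : ℂ} (hz : z.im ≠ 0) :
    Tendsto (fun i => cauchyTransform (μ i) z) l (𝓝 (cauchyTransform μ₀ z)) :=
  (ProbabilityMeasure.tendsto_iff_forall_integral_rclike_tendsto ℂ).1 h (resolventFun z hz)

/-- Near `w₀` the Cauchy transforms are Lipschitz with a constant independent of the measure, so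
convergence at the single point `w₀` allows the argument to move. Weak convergence is not assumed,
because the approximants in `exists_approx_hasRationalG` are controlled through their Cauchy
transforms only. -/
lemma tendsto_cauchyTransform_of_tendsto {ι : Type*} {l : Filter ι}
    {μ : ι → ProbabilityMeasure ℝ} {g : ℂ} {w : ι → ℂ} {w₀ : ℂ} (hw₀ : 0 < w₀.im)
    (h : Tendsto (fun i => cauchyTransform (μ i) w₀) l (𝓝 g)) (hw : Tendsto w l (𝓝 w₀)) :
    Tendsto (fun i => cauchyTransform (μ i) (w i)) l (𝓝 g) := by
  have him : Tendsto (fun i => (w i).im) l (𝓝 w₀.im) := (Complex.continuous_im.tendsto _).comp hw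
  have h1 : Tendsto (fun i => ‖w i - w₀‖ * (1 / |(w i).im| * (1 / |w₀.im|))) l (𝓝 0) := by
    have h2 : Tendsto (fun i => ‖w i - w₀‖) l (𝓝 0) := tendsto_iff_norm_sub_tendsto_zero.1 hw
    have h3 : Tendsto (fun i => 1 / |(w i).im| * (1 / |w₀.im|)) l
        (𝓝 (1 / |w₀.im| * (1 / |w₀.im|))) :=
      (tendsto_const_nhds.div him.abs (abs_pos.2 hw₀.ne').ne').mul_const _
    simpa using h2.mul h3
  have h4 : Tendsto (fun i => cauchyTransform (μ i) (w i) - cauchyTransform (μ i) w₀) l (𝓝 0) := by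
    refine squeeze_zero_norm' ?_ h1
    filter_upwards [him.eventually (lt_mem_nhds hw₀)] with i hi
    exact norm_cauchyTransform_sub_le (μ i) hi.ne' hw₀.ne'
  simpa using h4.add h

lemma tendsto_kTransform_of_cauchyTransform {ι : Type*} {l : Filter ι}
    {μ : ι → ProbabilityMeasure ℝ} {μ₀ : ProbabilityMeasure ℝ} {w : ι → ℂ} {w₀ : ℂ}
    (hw₀ : 0 < w₀.im)
    (h : Tendsto (fun i => cauchyTransform (μ i) w₀) l (𝓝 (cauchyTransform μ₀ w₀)))
    (hw : Tendsto w l (𝓝 w₀)) :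
    Tendsto (fun i => kTransform (μ i) (w i)) l (𝓝 (kTransform μ₀ w₀)) :=
  hw.sub (tendsto_const_nhds.div (tendsto_cauchyTransform_of_tendsto hw₀ h hw)
    (cauchyTransform_ne_zero μ₀ hw₀.ne'))

lemma tendsto_kTransform {ι : Type*} {l : Filter ι}
    {μ : ι → ProbabilityMeasure ℝ} {μ₀ : ProbabilityMeasure ℝ} {w : ι → ℂ} {w₀ : ℂ}
    (hw₀ : 0 < w₀.im) (h : Tendsto μ l (𝓝 μ₀)) (hw : Tendsto w l (𝓝 w₀)) :
    Tendsto (fun i => kTransform (μ i) (w i)) l (𝓝 (kTransform μ₀ w₀)) :=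
  tendsto_kTransform_of_cauchyTransform hw₀ (tendsto_cauchyTransform_left h hw₀.ne') hw

lemma tendsto_cauchyTransform_of_kTransform {ι : Type*} {l : Filter ι}
    {μ : ι → ProbabilityMeasure ℝ} {μ₀ : ProbabilityMeasure ℝ} {z : ℂ} (hz : 0 < z.im)
    (h : Tendsto (fun i => kTransform (μ i) z) l (𝓝 (kTransform μ₀ z))) :
    Tendsto (fun i => cauchyTransform (μ i) z) l (𝓝 (cauchyTransform μ₀ z)) := by
  simp only [cauchyTransform_eq_one_div]
  refine tendsto_const_nhds.div (tendsto_const_nhds.sub h) fun h0 => ?_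
  have := im_sub_kTransform_pos μ₀ hz
  rw [h0] at this
  simp at this

/-! ### Estimates far from the real axis -/

/-- The truncated absolute moment `∫ min(1, |t| / y) dμ(t)`. -/
noncomputable def truncMoment (μ : ProbabilityMeasure ℝ) (y : ℝ) : ℝ :=
  ∫ t : ℝ, min 1 (|t| / y) ∂(μ : Measure ℝ)

/-- The function `t ↦ min(1, |t| / y)`. -/
noncomputable def truncFun (y : ℝ) (hy : 0 < y) : ℝ →ᵇ ℝ :=
  BoundedContinuousFunction.ofNormedAddCommGroup (fun t : ℝ => min 1 (|t| / y))
    (by fun_prop) 1 (fun t => by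
      rw [Real.norm_of_nonneg (by positivity)]
      exact min_le_left _ _)

lemma integrable_trunc (μ : ProbabilityMeasure ℝ) {y : ℝ} (hy : 0 < y) :
    Integrable (fun t : ℝ => min 1 (|t| / y)) (μ : Measure ℝ) :=
  (truncFun y hy).integrable (μ : Measure ℝ)

lemma truncMoment_nonneg (μ : ProbabilityMeasure ℝ) {y : ℝ} (hy : 0 < y) :
    0 ≤ truncMoment μ y := integral_nonneg fun t => by positivity

lemma truncMoment_antitone (μ : ProbabilityMeasure ℝ) {x y : ℝ} (hx : 0 < x) (hxy : x ≤ y) :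
    truncMoment μ y ≤ truncMoment μ x := by
  refine integral_mono (integrable_trunc μ (hx.trans_le hxy)) (integrable_trunc μ hx) fun t => ?_
  dsimp only
  gcongr

lemma continuous_truncMoment {y : ℝ} (hy : 0 < y) : Continuous fun μ => truncMoment μ y :=
  ProbabilityMeasure.continuous_integral_boundedContinuousFunction (truncFun y hy)

lemma tendsto_truncMoment_atTop (μ : ProbabilityMeasure ℝ) :
    Tendsto (truncMoment μ) atTop (𝓝 0) := by
  have h := tendsto_integral_filter_of_dominated_convergence (μ := (μ : Measure ℝ)) (l := atTop)
    (F := fun (y : ℝ) (t : ℝ) => min 1 (|t| / y)) (f := fun _ => 0) (fun _ => 1) ?_ ?_ ?_ ?_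
  · rwa [integral_zero] at h
  · exact Eventually.of_forall fun y => by fun_prop
  · filter_upwards [eventually_gt_atTop 0] with y hy
    refine Eventually.of_forall fun t => ?_
    rw [Real.norm_of_nonneg (by positivity)]
    exact min_le_left _ _
  · exact integrable_const _
  · refine Eventually.of_forall fun t => ?_
    have h1 : Tendsto (fun y : ℝ => min 1 (|t| / y)) atTop (𝓝 (min 1 0)) :=
      tendsto_const_nhds.min (tendsto_const_nhds.div_atTop tendsto_id)
    simpa using h1

lemma half_le_im_of_norm_sub_le {y : ℝ} {w : ℂ} (hw : ‖w - y * I‖ ≤ y / 2) : y / 2 ≤ w.im := by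
  have h := (Complex.abs_im_le_norm (w - y * I)).trans hw
  simp only [Complex.sub_im, Complex.mul_im, Complex.ofReal_re, Complex.I_im, mul_one,
    Complex.ofReal_im, Complex.I_re, mul_zero, add_zero] at h
  linarith [(abs_le.1 h).1]

lemma norm_le_of_norm_sub_le {y : ℝ} {w : ℂ} (hy : 0 < y) (hw : ‖w - y * I‖ ≤ y / 2) :
    ‖w‖ ≤ 3 * y / 2 := by
  have h : ‖w‖ ≤ ‖w - y * I‖ + ‖(y : ℂ) * I‖ := by
    simpa using norm_add_le (w - y * I) (y * I)
  have h2 : ‖(y : ℂ) * I‖ = y := by simp [abs_of_pos hy]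
  linarith

lemma norm_div_sub_le {y : ℝ} {w : ℂ} (hy : 0 < y) (hw : ‖w - y * I‖ ≤ y / 2) (t : ℝ) :
    ‖(t : ℂ) / (w - t)‖ ≤ 4 * min 1 (|t| / y) := by
  have h1 : y / 2 ≤ ‖w - t‖ :=
    (half_le_im_of_norm_sub_le hw).trans ((le_abs_self _).trans (abs_im_le_norm_sub_ofReal w t))
  have h2 := norm_le_of_norm_sub_le hy hw
  have h0 : 0 < ‖w - t‖ := by linarith
  rw [norm_div, Complex.norm_real, Real.norm_eq_abs, mul_min_of_nonneg _ _ (by norm_num)]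
  refine le_min ?_ ?_
  -- As `‖w‖ ≤ 3y/2 ≤ 3‖w - t‖`, the triangle inequality gives `|t| ≤ 4‖w - t‖`.
  · rw [div_le_iff₀ h0]
    have : |t| ≤ ‖w‖ + ‖w - t‖ := by
      have := norm_sub_le w (w - t)
      rwa [sub_sub_cancel, Complex.norm_real, Real.norm_eq_abs] at this
    linarith
  · rw [div_le_iff₀ h0]
    calc |t| = 2 * (|t| / y) * (y / 2) := by field_simp
      _ ≤ 2 * (|t| / y) * ‖w - t‖ := by gcongr
      _ ≤ 4 * (|t| / y) * ‖w - t‖ := by gcongr; norm_num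

lemma mul_resolvent_eq {w : ℂ} {t : ℝ} (h : w - t ≠ 0) :
    w * (1 / (w - (t : ℂ))) = 1 + (t : ℂ) / (w - t) := by
  field_simp
  ring

lemma norm_mul_cauchyTransform_sub_one_le (μ : ProbabilityMeasure ℝ) {y : ℝ} {w : ℂ} (hy : 0 < y)
    (hw : ‖w - y * I‖ ≤ y / 2) :
    ‖w * cauchyTransform μ w - 1‖ ≤ 4 * truncMoment μ y := by
  have him : w.im ≠ 0 := by linarith [half_le_im_of_norm_sub_le hw]
  have h1 : w * cauchyTransform μ w - 1 =
      ∫ t : ℝ, (w * (1 / (w - (t : ℂ))) - 1) ∂(μ : Measure ℝ) := by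
    rw [integral_sub ((integrable_resolvent μ him).const_mul _) (integrable_const _),
      integral_const_mul, cauchyTransform]
    simp
  rw [h1, truncMoment, ← integral_const_mul]
  refine norm_integral_le_of_norm_le ((integrable_trunc μ hy).const_mul 4)
    (Eventually.of_forall fun t => ?_)
  rw [mul_resolvent_eq (sub_ofReal_ne_zero him t), add_sub_cancel_left]
  exact norm_div_sub_le hy hw t

lemma half_le_norm_of_norm_sub_one_le {a : ℂ} (h : ‖a - 1‖ ≤ 1 / 2) : 1 / 2 ≤ ‖a‖ := by
  have h1 := norm_sub_norm_le (1 : ℂ) (1 - a)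
  rw [norm_one, sub_sub_cancel, norm_sub_rev] at h1
  linarith

lemma norm_kTransform_le (μ : ProbabilityMeasure ℝ) {y : ℝ} {w : ℂ} (hy : 0 < y)
    (hw : ‖w - y * I‖ ≤ y / 2) (hμ : truncMoment μ y ≤ 1 / 8) :
    ‖kTransform μ w‖ ≤ 12 * y * truncMoment μ y := by
  have him : w.im ≠ 0 := by linarith [half_le_im_of_norm_sub_le hw]
  have h1 := norm_mul_cauchyTransform_sub_one_le μ hy hw
  -- The bound `τ ≤ 1/8` enters here: `4τ ≤ 1/2` keeps `wG(w)` away from `0`.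
  have h2 := half_le_norm_of_norm_sub_one_le (h1.trans (by linarith))
  have hG := cauchyTransform_ne_zero μ him
  have hw0 : w ≠ 0 := by rintro rfl; simp at him
  have hτ := truncMoment_nonneg μ hy
  have : kTransform μ w =
      w * ((w * cauchyTransform μ w - 1) / (w * cauchyTransform μ w)) := by
    rw [kTransform, fTransform]
    field_simp
  rw [this, norm_mul, norm_div]
  calc ‖w‖ * (‖w * cauchyTransform μ w - 1‖ / ‖w * cauchyTransform μ w‖)
      ≤ (3 * y / 2) * ((4 * truncMoment μ y) / (1 / 2)) := by
        gcongr
        exact norm_le_of_norm_sub_le hy hw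
    _ = 12 * y * truncMoment μ y := by ring

lemma norm_mul_integral_resolvent_mul_sub_one_le (μ : ProbabilityMeasure ℝ) {y : ℝ} {w w' : ℂ}
    (hy : 0 < y) (hw : ‖w - y * I‖ ≤ y / 2) (hw' : ‖w' - y * I‖ ≤ y / 2) :
    ‖w * w' * (∫ t : ℝ, 1 / (w - (t : ℂ)) * (1 / (w' - (t : ℂ))) ∂(μ : Measure ℝ)) - 1‖ ≤
      24 * truncMoment μ y := by
  have him : w.im ≠ 0 := by linarith [half_le_im_of_norm_sub_le hw]
  have him' : w'.im ≠ 0 := by linarith [half_le_im_of_norm_sub_le hw']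
  have hint : Integrable (fun t : ℝ => 1 / (w - (t : ℂ)) * (1 / (w' - (t : ℂ)))) (μ : Measure ℝ) :=
    (resolventFun w him * resolventFun w' him').integrable (μ : Measure ℝ)
  have h1 : w * w' * (∫ t : ℝ, 1 / (w - (t : ℂ)) * (1 / (w' - (t : ℂ))) ∂(μ : Measure ℝ)) - 1 =
      ∫ t : ℝ, (w * w' * (1 / (w - (t : ℂ)) * (1 / (w' - (t : ℂ)))) - 1) ∂(μ : Measure ℝ) := by
    rw [integral_sub (hint.const_mul _) (integrable_const _), integral_const_mul]
    simp
  rw [h1, truncMoment, ← integral_const_mul]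
  refine norm_integral_le_of_norm_le ((integrable_trunc μ hy).const_mul 24)
    (Eventually.of_forall fun t => ?_)
  have h2 : w * w' * (1 / (w - (t : ℂ)) * (1 / (w' - (t : ℂ)))) - 1 =
      (t : ℂ) / (w - t) + (t : ℂ) / (w' - t) + (t : ℂ) / (w - t) * ((t : ℂ) / (w' - t)) := by
    have e1 := mul_resolvent_eq (sub_ofReal_ne_zero him t)
    have e2 := mul_resolvent_eq (sub_ofReal_ne_zero him' t)
    calc _ = (w * (1 / (w - (t : ℂ)))) * (w' * (1 / (w' - (t : ℂ)))) - 1 := by ring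
      _ = _ := by rw [e1, e2]; ring
  rw [h2]
  have h3 := norm_div_sub_le hy hw t
  have h4 := norm_div_sub_le hy hw' t
  have hm0 : 0 ≤ min 1 (|t| / y) := by positivity
  have hm1 : min 1 (|t| / y) ≤ 1 := min_le_left _ _
  set m := min 1 (|t| / y)
  calc _ ≤ ‖(t : ℂ) / (w - t)‖ + ‖(t : ℂ) / (w' - t)‖ +
        ‖(t : ℂ) / (w - t)‖ * ‖(t : ℂ) / (w' - t)‖ := by
        refine (norm_add_le _ _).trans (add_le_add (norm_add_le _ _) (norm_mul_le _ _))
    _ ≤ 4 * m + 4 * m + 4 * m * (4 * m) := by gcongr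
    _ ≤ 24 * m := by nlinarith

/-- The difference quotient of `K` is `1 - ww'J / (wG · w'G')`, where `wG`, `w'G'` and `ww'J` are
all within `O(τ)` of `1`. -/
lemma norm_kTransform_sub_le (μ : ProbabilityMeasure ℝ) {y : ℝ} {w w' : ℂ} (hy : 0 < y)
    (hw : ‖w - y * I‖ ≤ y / 2) (hw' : ‖w' - y * I‖ ≤ y / 2) (hμ : truncMoment μ y ≤ 1 / 8) :
    ‖kTransform μ w - kTransform μ w'‖ ≤ 136 * truncMoment μ y * ‖w - w'‖ := by
  have him : w.im ≠ 0 := by linarith [half_le_im_of_norm_sub_le hw]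
  have him' : w'.im ≠ 0 := by linarith [half_le_im_of_norm_sub_le hw']
  have hτ := truncMoment_nonneg μ hy
  set J := ∫ t : ℝ, 1 / (w - (t : ℂ)) * (1 / (w' - (t : ℂ))) ∂(μ : Measure ℝ) with hJ
  have h1 := norm_mul_cauchyTransform_sub_one_le μ hy hw
  have h1' := norm_mul_cauchyTransform_sub_one_le μ hy hw'
  have h2 := half_le_norm_of_norm_sub_one_le (h1.trans (by linarith))
  have h2' := half_le_norm_of_norm_sub_one_le (h1'.trans (by linarith))
  have h3 := norm_mul_integral_resolvent_mul_sub_one_le μ hy hw hw'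
  rw [← hJ] at h3
  have hG := cauchyTransform_ne_zero μ him
  have hG' := cauchyTransform_ne_zero μ him'
  have hw0 : w ≠ 0 := by rintro rfl; simp at him
  have hw0' : w' ≠ 0 := by rintro rfl; simp at him'
  have hdiff : cauchyTransform μ w - cauchyTransform μ w' = (w' - w) * J := by
    rw [hJ, cauchyTransform, cauchyTransform,
      ← integral_sub (integrable_resolvent μ him) (integrable_resolvent μ him'),
      ← integral_const_mul]
    congr 1
    ext t
    have := sub_ofReal_ne_zero him t
    have := sub_ofReal_ne_zero him' t
    field_simp
    ring
  set g := cauchyTransform μ w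
  set g' := cauchyTransform μ w'
  set τ := truncMoment μ y
  -- The numerator is `wG · w'G' - ww'J`, rearranged so that each summand is small. Its norm is at
  -- most `16τ² + 32τ ≤ 34τ`, and dividing by the lower bound `1/4` for the denominator gives
  -- `136τ`.
  have hK : kTransform μ w - kTransform μ w' =
      (((w * g - 1) * (w' * g' - 1) + (w * g - 1) + (w' * g' - 1) - (w * w' * J - 1)) /
        ((w * g) * (w' * g'))) * (w - w') := by
    have e : kTransform μ w - kTransform μ w' = (w - w') - (g' - g) / (g * g') := by
      simp only [kTransform, fTransform]
      change w - 1 / g - (w' - 1 / g') = _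
      field_simp
      ring
    have e2 : g' - g = (w - w') * J := by linear_combination -hdiff
    rw [e, e2]
    field_simp
    ring
  rw [hK, norm_mul, norm_div, norm_mul (w * g)]
  gcongr
  have h5 : ‖(w * g - 1) * (w' * g' - 1) + (w * g - 1) + (w' * g' - 1) - (w * w' * J - 1)‖ ≤
      34 * τ := by
    calc _ ≤ ‖w * g - 1‖ * ‖w' * g' - 1‖ + ‖w * g - 1‖ + ‖w' * g' - 1‖ + ‖w * w' * J - 1‖ := by
          refine (norm_sub_le _ _).trans (add_le_add ((norm_add_le _ _).trans
            (add_le_add ((norm_add_le _ _).trans (add_le_add (norm_mul_le _ _) le_rfl)) le_rfl))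
            le_rfl)
      _ ≤ 4 * τ * (4 * τ) + 4 * τ + 4 * τ + 24 * τ := by gcongr
      _ ≤ 34 * τ := by nlinarith
  calc _ ≤ 34 * τ / (1 / 2 * (1 / 2)) := by gcongr
    _ = 136 * τ := by ring

/-! ### Tails, tightness and compactness -/

lemma mul_I_im_pos {y : ℝ} (hy : 0 < y) : 0 < ((y : ℂ) * I).im := by simpa using hy

lemma norm_ofReal_mul_I_sub_self_le {y : ℝ} (hy : 0 < y) : ‖(y : ℂ) * I - y * I‖ ≤ y / 2 := by
  rw [sub_self, norm_zero]
  positivity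

/-- The real part of `1 - iyG(iy)` is `∫ t²/(y² + t²)`, and the integrand is at least `1/2` where
`|t| > y`. -/
lemma measure_lt_norm_le (μ : ProbabilityMeasure ℝ) {y : ℝ} (hy : 0 < y) :
    (μ : Measure ℝ) {t | y < ‖t‖} ≤
      ENNReal.ofReal (2 * ‖y * I * cauchyTransform μ (y * I) - 1‖) := by
  have him := (mul_I_im_pos hy).ne'
  have hi : Integrable (fun t : ℝ => (y : ℂ) * I * (1 / (y * I - (t : ℂ))) - 1) (μ : Measure ℝ) :=
    ((integrable_resolvent μ him).const_mul _).sub (integrable_const _)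
  have h1 : (y : ℂ) * I * cauchyTransform μ (y * I) - 1 =
      ∫ t : ℝ, ((y : ℂ) * I * (1 / (y * I - (t : ℂ))) - 1) ∂(μ : Measure ℝ) := by
    rw [integral_sub ((integrable_resolvent μ him).const_mul _) (integrable_const _),
      integral_const_mul, cauchyTransform]
    simp
  have hre : ∀ t : ℝ, ((y : ℂ) * I * (1 / (y * I - (t : ℂ))) - 1).re = -(t ^ 2 / (y ^ 2 + t ^ 2)) := by
    intro t
    have : y ^ 2 + t ^ 2 ≠ 0 := by positivity
    have : t * t + y * y ≠ 0 := by nlinarith [mul_pos hy hy, mul_self_nonneg t]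
    simp [Complex.mul_re, Complex.mul_im, Complex.normSq_apply]
    field_simp
    ring
  have h2 : ∫ t : ℝ, 2 * (t ^ 2 / (y ^ 2 + t ^ 2)) ∂(μ : Measure ℝ) ≤
      2 * ‖y * I * cauchyTransform μ (y * I) - 1‖ := by
    have h3 := integral_re hi
    simp only [RCLike.re_to_complex, hre, integral_neg] at h3
    rw [← h1] at h3
    rw [integral_const_mul]
    have h4 := Complex.abs_re_le_norm ((y : ℂ) * I * cauchyTransform μ (y * I) - 1)
    have h5 := (abs_le.1 h4).1
    linarith
  have hi2 : Integrable (fun t : ℝ => 2 * (t ^ 2 / (y ^ 2 + t ^ 2))) (μ : Measure ℝ) := by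
    refine (hi.re.const_mul (-2)).congr (Eventually.of_forall fun t => ?_)
    simp only [RCLike.re_to_complex, hre]
    ring
  have hm : MeasurableSet {t : ℝ | y < ‖t‖} := measurableSet_lt measurable_const measurable_norm
  have h6 : (μ : Measure ℝ).real {t | y < ‖t‖} ≤
      ∫ t : ℝ, 2 * (t ^ 2 / (y ^ 2 + t ^ 2)) ∂(μ : Measure ℝ) := by
    rw [← integral_indicator_one hm]
    refine integral_mono ((integrable_const (1 : ℝ)).indicator hm) hi2 fun t => ?_
    by_cases ht : y < ‖t‖
    · rw [Set.indicator_of_mem (show t ∈ {t : ℝ | y < ‖t‖} from ht)]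
      have : y ^ 2 ≤ t ^ 2 := by
        rw [← sq_abs t]
        exact pow_le_pow_left₀ hy.le ht.le 2
      simp only [Pi.one_apply]
      rw [← mul_div_assoc, le_div_iff₀ (by positivity)]
      linarith
    · rw [Set.indicator_of_notMem (show t ∉ {t : ℝ | y < ‖t‖} from ht)]
      positivity
  rw [← ENNReal.ofReal_toReal (measure_ne_top (μ : Measure ℝ) {t | y < ‖t‖})]
  exact ENNReal.ofReal_le_ofReal (h6.trans h2)

/-- In the limit, the tail beyond `y` is at most `8 τ(y)` for the limit measure, which vanishes as
`y → ∞`. That the limit is the transform of a probability measure is what prevents escape of mass.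
-/
lemma isTightMeasureSet_range_of_tendsto_cauchyTransform {μ : ℕ → ProbabilityMeasure ℝ}
    {μ₀ : ProbabilityMeasure ℝ} {y₀ : ℝ} (hy₀ : 0 < y₀)
    (h : ∀ y : ℝ, y₀ ≤ y → Tendsto (fun n => cauchyTransform (μ n) (y * I)) atTop
      (𝓝 (cauchyTransform μ₀ (y * I)))) :
    IsTightMeasureSet (Set.range fun n => (μ n : Measure ℝ)) := by
  refine isTightMeasureSet_range_of_tendsto_limsup_measure_norm_gt ?_
  have h0 : Tendsto (fun y => ENNReal.ofReal (2 * (4 * truncMoment μ₀ y))) atTop (𝓝 0) := by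
    rw [← ENNReal.ofReal_zero]
    refine ENNReal.tendsto_ofReal ?_
    simpa using ((tendsto_truncMoment_atTop μ₀).const_mul 4).const_mul 2
  refine tendsto_of_tendsto_of_tendsto_of_le_of_le' tendsto_const_nhds h0
    (Eventually.of_forall fun _ => zero_le) ?_
  filter_upwards [eventually_ge_atTop y₀] with y hy
  have hy' := hy₀.trans_le hy
  have h1 : Tendsto (fun n => ENNReal.ofReal (2 * ‖y * I * cauchyTransform (μ n) (y * I) - 1‖)) atTop
      (𝓝 (ENNReal.ofReal (2 * ‖y * I * cauchyTransform μ₀ (y * I) - 1‖))) :=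
    ENNReal.tendsto_ofReal ((((h y hy).const_mul _).sub_const _).norm.const_mul _)
  calc limsup (fun n => (μ n : Measure ℝ) {x | y < ‖x‖}) atTop
      ≤ limsup (fun n => ENNReal.ofReal (2 * ‖y * I * cauchyTransform (μ n) (y * I) - 1‖)) atTop :=
        limsup_le_limsup (Eventually.of_forall fun n => measure_lt_norm_le (μ n) hy')
    _ = _ := h1.limsup_eq
    _ ≤ _ := by
        gcongr
        exact norm_mul_cauchyTransform_sub_one_le μ₀ hy' (norm_ofReal_mul_I_sub_self_le hy')

lemma norm_mul_cauchyTransform_sub_one_le_of_kTransform {μ : ProbabilityMeasure ℝ} {y ε : ℝ}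
    (hy : 0 < y) (h : ‖kTransform μ (y * I)‖ ≤ ε * y) :
    ‖y * I * cauchyTransform μ (y * I) - 1‖ ≤ 2 * ε := by
  have h0 : y ≤ ‖y * I - kTransform μ (y * I)‖ := by
    have h1 := im_le_im_sub_kTransform μ (mul_I_im_pos hy)
    have h2 := (le_abs_self _).trans (Complex.abs_im_le_norm (y * I - kTransform μ (y * I)))
    simp only [Complex.mul_im, Complex.ofReal_re, Complex.I_im, mul_one, Complex.ofReal_im,
      Complex.I_re, mul_zero, add_zero] at h1
    linarith
  have h3 : (y * I - kTransform μ (y * I)) ≠ 0 := norm_pos_iff.1 (hy.trans_le h0)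
  have h4 : y * I * cauchyTransform μ (y * I) - 1 =
      kTransform μ (y * I) / (y * I - kTransform μ (y * I)) := by
    rw [cauchyTransform_eq_one_div]
    field_simp
    ring
  have hε0 : 0 ≤ ε * y := (norm_nonneg _).trans h
  have hε1 : 0 ≤ ε := nonneg_of_mul_nonneg_left hε0 hy
  rw [h4, norm_div, div_le_iff₀ (by linarith)]
  nlinarith

/-- A sequence of probability measures whose `K`-transforms are uniformly `o(y)` along the imaginary
axis has a weakly convergent subsequence. -/
lemma exists_subseq_tendsto {μ : ℕ → ProbabilityMeasure ℝ}
    (h : ∀ ε : ℝ, 0 < ε → ∃ y : ℝ, 0 < y ∧ ∀ n, ‖kTransform (μ n) (y * I)‖ ≤ ε * y) :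
    ∃ (μ₀ : ProbabilityMeasure ℝ) (φ : ℕ → ℕ), StrictMono φ ∧ Tendsto (μ ∘ φ) atTop (𝓝 μ₀) := by
  have hT : IsTightMeasureSet {((ν : ProbabilityMeasure ℝ) : Measure ℝ) | ν ∈ Set.range μ} := by
    rw [isTightMeasureSet_iff_exists_isCompact_measure_compl_le]
    intro ε hε
    obtain ⟨δ, hδ, hδε⟩ : ∃ δ : ℝ, 0 < δ ∧ ENNReal.ofReal δ ≤ ε := by
      rcases eq_or_ne ε ⊤ with rfl | htop
      · exact ⟨1, one_pos, le_top⟩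
      · exact ⟨ε.toReal, ENNReal.toReal_pos hε.ne' htop, ENNReal.ofReal_toReal_le⟩
    -- One factor `2` is lost in the tail bound and one in passing from `K` to `G`.
    obtain ⟨y, hy, hK⟩ := h (δ / 4) (by positivity)
    refine ⟨Metric.closedBall 0 y, isCompact_closedBall 0 y, ?_⟩
    rintro _ ⟨_, ⟨n, rfl⟩, rfl⟩
    have h1 : (Metric.closedBall (0 : ℝ) y)ᶜ = {t | y < ‖t‖} := by ext; simp
    rw [h1]
    refine (measure_lt_norm_le (μ n) hy).trans (le_trans (ENNReal.ofReal_le_ofReal ?_) hδε)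
    have h2 := norm_mul_cauchyTransform_sub_one_le_of_kTransform hy (hK n)
    linarith
  obtain ⟨μ₀, -, φ, hφ, hlim⟩ := (isCompact_closure_of_isTightMeasureSet hT).tendsto_subseq
    (x := μ) fun n => subset_closure ⟨n, rfl⟩
  exact ⟨μ₀, φ, hφ, hlim⟩

/-! ### Weak convergence from convergence of Cauchy transforms -/

/-- The linear span of the constants and of the functions `t ↦ 1 / (z - t)` for `z = i y`,
`y₀ ≤ |y|`. -/
noncomputable def resolventSpan (y₀ : ℝ) : Submodule ℂ (ℝ →ᵇ ℂ) :=
  Submodule.span ℂ ({1} ∪ {f | ∃ (y : ℝ) (hy : ((y : ℂ) * I).im ≠ 0), y₀ ≤ |y| ∧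
    f = resolventFun (y * I) hy})

lemma one_mem_resolventSpan (y₀ : ℝ) : (1 : ℝ →ᵇ ℂ) ∈ resolventSpan y₀ :=
  Submodule.subset_span (Or.inl rfl)

lemma resolventFun_mem_resolventSpan {y₀ y : ℝ} (hy : ((y : ℂ) * I).im ≠ 0) (h : y₀ ≤ |y|) :
    resolventFun (y * I) hy ∈ resolventSpan y₀ :=
  Submodule.subset_span (Or.inr ⟨y, hy, h, rfl⟩)

lemma resolventFun_mul_resolventFun {z w : ℂ} (hz : z.im ≠ 0) (hw : w.im ≠ 0) (hzw : z ≠ w) :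
    resolventFun z hz * resolventFun w hw =
      (w - z)⁻¹ • (resolventFun z hz - resolventFun w hw) := by
  ext t
  have h1 := sub_ofReal_ne_zero hz t
  have h2 := sub_ofReal_ne_zero hw t
  have h3 : w - z ≠ 0 := sub_ne_zero.2 hzw.symm
  simp only [BoundedContinuousFunction.coe_mul, Pi.mul_apply, resolventFun_apply,
    BoundedContinuousFunction.coe_smul, BoundedContinuousFunction.coe_sub, Pi.sub_apply,
    smul_eq_mul]
  field_simp
  ring

lemma dist_resolventFun_le {z w : ℂ} (hz : z.im ≠ 0) (hw : w.im ≠ 0) :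
    dist (resolventFun z hz) (resolventFun w hw) ≤ ‖z - w‖ * (1 / |z.im| * (1 / |w.im|)) := by
  refine (BoundedContinuousFunction.dist_le (by positivity)).2 fun t => ?_
  have h1 := sub_ofReal_ne_zero hz t
  have h2 := sub_ofReal_ne_zero hw t
  have : 1 / (z - (t : ℂ)) - 1 / (w - (t : ℂ)) =
      (w - z) * (1 / (z - (t : ℂ)) * (1 / (w - (t : ℂ)))) := by
    field_simp
    ring
  rw [resolventFun_apply, resolventFun_apply, dist_eq_norm, this, norm_mul, norm_mul, norm_sub_rev]
  gcongr
  · exact norm_one_div_sub_le hz t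
  · exact norm_one_div_sub_le hw t

lemma resolventFun_mul_mem_closure {y₀ : ℝ} (hy₀ : 0 < y₀) {x y : ℝ} (hx : ((x : ℂ) * I).im ≠ 0)
    (hy : ((y : ℂ) * I).im ≠ 0) (hx₀ : y₀ ≤ |x|) (hy' : y₀ ≤ |y|) :
    resolventFun (x * I) hx * resolventFun (y * I) hy ∈ (resolventSpan y₀).topologicalClosure := by
  have key : ∀ (u : ℝ) (hu : ((u : ℂ) * I).im ≠ 0), y₀ ≤ |u| → x ≠ u →
      resolventFun (x * I) hx * resolventFun (u * I) hu ∈ resolventSpan y₀ := by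
    intro u hu hu₀ hxu
    rw [resolventFun_mul_resolventFun hx hu (by simpa using hxu)]
    exact Submodule.smul_mem _ _ (Submodule.sub_mem _ (resolventFun_mem_resolventSpan hx hx₀)
      (resolventFun_mem_resolventSpan hu hu₀))
  by_cases hxy : x = y
  · subst hxy
    have hx1 : x ≠ 0 := by simpa using hx
    have hxpos : 0 < |x| := abs_pos.2 hx1
    -- The resolvent identity does not apply to a square, so the square is reached as a limit of
    -- products at distinct points. Moving `x` away from `0` keeps `|u n| ≥ y₀`.
    set u : ℕ → ℝ := fun n => x * (1 + 1 / ((n : ℝ) + 1)) with hu_def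
    have hfac : ∀ n : ℕ, (1 : ℝ) < 1 + 1 / ((n : ℝ) + 1) := fun n => by
      have : (0 : ℝ) < 1 / ((n : ℝ) + 1) := by positivity
      linarith
    have habs : ∀ n, |x| ≤ |u n| := fun n => by
      rw [hu_def, abs_mul, abs_of_pos (by linarith [hfac n] : (0 : ℝ) < 1 + 1 / ((n : ℝ) + 1))]
      nlinarith [hfac n]
    have hu : ∀ n, ((u n : ℂ) * I).im ≠ 0 := fun n => by
      simpa using abs_pos.1 (hxpos.trans_le (habs n))
    have hlim : Tendsto u atTop (𝓝 x) := by
      have := (tendsto_one_div_add_atTop_nhds_zero_nat (𝕜 := ℝ)).const_add 1 |>.const_mul x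
      rw [add_zero, mul_one] at this
      exact this
    have hR : Tendsto (fun n => resolventFun (u n * I) (hu n)) atTop
        (𝓝 (resolventFun (x * I) hx)) := by
      refine tendsto_iff_dist_tendsto_zero.2 ?_
      have h0 : Tendsto (fun n => ‖(u n : ℂ) * I - x * I‖ * (1 / |x| * (1 / |x|))) atTop
          (𝓝 0) := by
        have h1 : Tendsto (fun n => ((u n : ℝ) : ℂ)) atTop (𝓝 (x : ℂ)) :=
          (Complex.continuous_ofReal.tendsto x).comp hlim
        have := ((h1.mul_const I).sub_const (x * I)).norm.mul_const (1 / |x| * (1 / |x|))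
        simpa using this
      refine squeeze_zero (fun _ => dist_nonneg) (fun n => ?_) h0
      refine (dist_resolventFun_le (hu n) hx).trans ?_
      have h2 : |((u n : ℂ) * I).im| = |u n| := by simp
      have h3 : |((x : ℂ) * I).im| = |x| := by simp
      rw [h2, h3]
      have := habs n
      gcongr
    refine mem_closure_of_tendsto (tendsto_const_nhds.mul hR)
      (Eventually.of_forall fun n => key (u n) (hu n) (hx₀.trans (habs n)) fun h => ?_)
    have h1 : x * 1 = x * (1 + 1 / ((n : ℝ) + 1)) := by rw [mul_one]; exact h
    linarith [mul_left_cancel₀ hx1 h1, hfac n]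
  · exact Submodule.le_topologicalClosure _ (key y hy hy' hxy)

lemma mul_mem_closure_resolventSpan {y₀ : ℝ} (hy₀ : 0 < y₀) {f g : ℝ →ᵇ ℂ}
    (hf : f ∈ (resolventSpan y₀).topologicalClosure)
    (hg : g ∈ (resolventSpan y₀).topologicalClosure) :
    f * g ∈ (resolventSpan y₀).topologicalClosure := by
  have h1 : resolventSpan y₀ * resolventSpan y₀ ≤ (resolventSpan y₀).topologicalClosure := by
    conv_lhs => rw [resolventSpan, Submodule.span_mul_span]
    refine Submodule.span_le.2 ?_
    have hle := Submodule.le_topologicalClosure (resolventSpan y₀)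
    rintro _ ⟨a, ha | ⟨x, hx, hx₀, rfl⟩, b, hb | ⟨y, hy, hy₁, rfl⟩, rfl⟩
    · rw [Set.mem_singleton_iff] at ha hb
      subst ha hb
      simpa only [mul_one] using! hle (one_mem_resolventSpan y₀)
    · rw [Set.mem_singleton_iff] at ha
      subst ha
      simpa only [one_mul] using! hle (resolventFun_mem_resolventSpan hy hy₁)
    · rw [Set.mem_singleton_iff] at hb
      subst hb
      simpa only [mul_one] using! hle (resolventFun_mem_resolventSpan hx hx₀)
    · exact resolventFun_mul_mem_closure hy₀ hx hy hx₀ hy₁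
  have h2 : f * g ∈ closure ((resolventSpan y₀).topologicalClosure : Set (ℝ →ᵇ ℂ)) :=
    map_mem_closure₂ continuous_mul hf hg fun a ha b hb => h1 (Submodule.mul_mem_mul ha hb)
  rwa [(resolventSpan y₀).isClosed_topologicalClosure.closure_eq] at h2

/-- Conjugation exchanges `iy` and `-iy`; this is why the span includes both signs of `y`. -/
lemma star_mem_closure_resolventSpan {y₀ : ℝ} {f : ℝ →ᵇ ℂ}
    (hf : f ∈ (resolventSpan y₀).topologicalClosure) :
    star f ∈ (resolventSpan y₀).topologicalClosure := by
  refine map_mem_closure continuous_star hf fun g hg => ?_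
  change star g ∈ resolventSpan y₀
  refine Submodule.span_induction ?_ ?_ ?_ ?_ hg
  · rintro _ (h | ⟨y, hy, hy₀, rfl⟩)
    · rw [Set.mem_singleton_iff] at h
      subst h
      simpa using one_mem_resolventSpan y₀
    · have hy' : (((-y : ℝ) : ℂ) * I).im ≠ 0 := by simpa using hy
      have : star (resolventFun (y * I) hy) = resolventFun ((-y : ℝ) * I) hy' := by
        ext t
        simp
      rw [this]
      exact resolventFun_mem_resolventSpan hy' (by rwa [abs_neg])
  · simp
  · intro a b _ _ ha hb
    rw [star_add]
    exact Submodule.add_mem _ ha hb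
  · intro c a _ ha
    rw [star_smul]
    exact Submodule.smul_mem _ _ ha

/-- The closed span of the resolvent functions, as a star subalgebra. -/
noncomputable def resolventAlgebra (y₀ : ℝ) (hy₀ : 0 < y₀) : StarSubalgebra ℂ (ℝ →ᵇ ℂ) where
  carrier := (resolventSpan y₀).topologicalClosure
  mul_mem' := mul_mem_closure_resolventSpan hy₀
  add_mem' := Submodule.add_mem _
  algebraMap_mem' c := by
    rw [Algebra.algebraMap_eq_smul_one]
    exact Submodule.smul_mem _ _ (Submodule.le_topologicalClosure _ (one_mem_resolventSpan y₀))
  star_mem' := star_mem_closure_resolventSpan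

lemma separatesPoints_resolventAlgebra (y₀ : ℝ) (hy₀ : 0 < y₀) :
    ((resolventAlgebra y₀ hy₀).map (toContinuousMapStarₐ ℂ)).SeparatesPoints := by
  intro s t hst
  have him := (mul_I_im_pos hy₀).ne'
  have hmem : resolventFun (y₀ * I) him ∈ resolventAlgebra y₀ hy₀ :=
    Submodule.le_topologicalClosure _ (resolventFun_mem_resolventSpan him (le_abs_self y₀))
  refine ⟨_, ⟨_, ⟨_, hmem, rfl⟩, rfl⟩, ?_⟩
  change (1 : ℂ) / (y₀ * I - (s : ℂ)) ≠ 1 / (y₀ * I - (t : ℂ))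
  intro h
  rw [one_div, one_div, inv_inj, sub_right_inj, Complex.ofReal_inj] at h
  exact hst h

/-- If the integrals converge on a set of bounded continuous functions, they converge on the
closure of this set. -/
lemma tendsto_integral_of_mem_closure {μ : ℕ → ProbabilityMeasure ℝ} {μ₀ : ProbabilityMeasure ℝ}
    {S : Set (ℝ →ᵇ ℂ)}
    (h : ∀ f ∈ S, Tendsto (fun n => ∫ t, f t ∂(μ n : Measure ℝ)) atTop
      (𝓝 (∫ t, f t ∂(μ₀ : Measure ℝ))))
    {f : ℝ →ᵇ ℂ} (hf : f ∈ closure S) :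
    Tendsto (fun n => ∫ t, f t ∂(μ n : Measure ℝ)) atTop (𝓝 (∫ t, f t ∂(μ₀ : Measure ℝ))) := by
  have hdist : ∀ (ν : ProbabilityMeasure ℝ) (g : ℝ →ᵇ ℂ),
      dist (∫ t, f t ∂(ν : Measure ℝ)) (∫ t, g t ∂(ν : Measure ℝ)) ≤ dist f g := by
    intro ν g
    rw [dist_eq_norm, ← integral_sub (f.integrable _) (g.integrable _)]
    refine (norm_integral_le_of_norm_le_const (C := dist f g) (Eventually.of_forall fun t => ?_)).trans
      (by simp)
    rw [← dist_eq_norm]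
    exact BoundedContinuousFunction.dist_coe_le_dist t
  rw [Metric.tendsto_atTop]
  intro ε hε
  obtain ⟨g, hg, hfg⟩ := Metric.mem_closure_iff.1 hf (ε / 3) (by positivity)
  obtain ⟨n₀, hn₀⟩ := Metric.tendsto_atTop.1 (h g hg) (ε / 3) (by positivity)
  refine ⟨n₀, fun n hn => ?_⟩
  have h1 := hdist (μ n) g
  have h2 := hdist μ₀ g
  rw [dist_comm] at h2
  have h3 := dist_triangle4 (∫ t, f t ∂(μ n : Measure ℝ)) (∫ t, g t ∂(μ n : Measure ℝ))
    (∫ t, g t ∂(μ₀ : Measure ℝ)) (∫ t, f t ∂(μ₀ : Measure ℝ))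
  linarith [hn₀ n hn]

/-- Pointwise convergence of Cauchy transforms far up the imaginary axis, to the Cauchy transform of
a probability measure, implies weak convergence. -/
theorem tendsto_of_tendsto_cauchyTransform {μ : ℕ → ProbabilityMeasure ℝ}
    {μ₀ : ProbabilityMeasure ℝ} {y₀ : ℝ} (hy₀ : 0 < y₀)
    (h : ∀ y : ℝ, y₀ ≤ y → Tendsto (fun n => cauchyTransform (μ n) (y * I)) atTop
      (𝓝 (cauchyTransform μ₀ (y * I)))) :
    Tendsto μ atTop (𝓝 μ₀) := by
  refine ProbabilityMeasure.tendsto_of_tight_of_separatesPoints ℂ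
    (isTightMeasureSet_range_of_tendsto_cauchyTransform hy₀ h)
    (separatesPoints_resolventAlgebra y₀ hy₀) fun g hg => ?_
  refine tendsto_integral_of_mem_closure (S := resolventSpan y₀) (fun f hf => ?_) hg
  refine Submodule.span_induction ?_ ?_ ?_ ?_ hf
  · rintro _ (h1 | ⟨y, hy, hy₁, rfl⟩)
    · rw [Set.mem_singleton_iff] at h1
      subst h1
      simp
    · rcases le_abs.1 hy₁ with hy₂ | hy₂
      · exact h y hy₂
      · have hconj : ∀ ν : ProbabilityMeasure ℝ, ∫ t, resolventFun (y * I) hy t ∂(ν : Measure ℝ) =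
            (starRingEnd ℂ) (cauchyTransform ν ((-y : ℝ) * I)) := by
          intro ν
          rw [cauchyTransform, ← integral_conj]
          congr 1
          ext t
          simp
        simp only [hconj]
        exact (Complex.continuous_conj.tendsto _).comp (h (-y) hy₂)
  · simp
  · intro a b _ _ ha hb
    have hadd : ∀ ν : ProbabilityMeasure ℝ, ∫ t, (a + b) t ∂(ν : Measure ℝ) =
        ∫ t, a t ∂(ν : Measure ℝ) + ∫ t, b t ∂(ν : Measure ℝ) := fun ν =>
      integral_add (a.integrable _) (b.integrable _)
    simp only [hadd]
    exact ha.add hb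
  · intro c a _ ha
    have hsmul : ∀ ν : ProbabilityMeasure ℝ, ∫ t, (c • a) t ∂(ν : Measure ℝ) =
        c * ∫ t, a t ∂(ν : Measure ℝ) := fun ν => integral_const_mul c _
    simp only [hsmul]
    exact ha.const_mul c

theorem eq_of_cauchyTransform_eq {μ ν : ProbabilityMeasure ℝ} {y₀ : ℝ} (hy₀ : 0 < y₀)
    (h : ∀ y : ℝ, y₀ ≤ y → cauchyTransform μ (y * I) = cauchyTransform ν (y * I)) : μ = ν :=
  tendsto_nhds_unique (tendsto_const_nhds (x := μ) (f := (atTop : Filter ℕ)))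
    (tendsto_of_tendsto_cauchyTransform hy₀ fun y hy => by
      rw [h y hy]
      exact tendsto_const_nhds)

theorem eq_of_kTransform_eq {μ ν : ProbabilityMeasure ℝ}
    (h : ∀ z : ℂ, 0 < z.im → kTransform μ z = kTransform ν z) : μ = ν :=
  eq_of_cauchyTransform_eq one_pos fun y hy => by
    rw [cauchyTransform_eq_one_div, cauchyTransform_eq_one_div,
      h _ (mul_I_im_pos (one_pos.trans_le hy))]

/-! ### Resolvents of symmetric operators on finite-dimensional spaces -/

/-- Expand in an orthonormal eigenbasis: the nodes are the eigenvalues and the weights are `|⟪w_i,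
u⟫|²`. The resolvent vector `y` enters through the equation it solves, so no inverse operator has to
be constructed. -/
lemma exists_inner_eq_sum_of_isSymmetric {E : Type*} [NormedAddCommGroup E] [InnerProductSpace ℂ E]
    [FiniteDimensional ℂ E] {T : E →ₗ[ℂ] E} (hT : T.IsSymmetric) (u : E) :
    ∃ (n : ℕ) (c t : Fin n → ℝ), (∀ i, 0 ≤ c i) ∧ ∑ i, c i = ‖u‖ ^ 2 ∧
      ∀ z : ℂ, 0 < z.im → ∀ y : E, z • y - T y = u → inner ℂ u y = ∑ i, (c i : ℂ) / (z - t i) := by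
  refine ⟨_, fun i => ‖inner ℂ (hT.eigenvectorBasis rfl i) u‖ ^ 2, hT.eigenvalues rfl,
    fun i => sq_nonneg _, (hT.eigenvectorBasis rfl).sum_sq_norm_inner_right u, fun z hz y hy => ?_⟩
  rw [← (hT.eigenvectorBasis rfl).sum_inner_mul_inner u y]
  refine Finset.sum_congr rfl fun i _ => ?_
  set w := hT.eigenvectorBasis rfl i
  have hne := sub_ofReal_ne_zero hz.ne' (hT.eigenvalues rfl i)
  have h1 : inner ℂ w u = (z - hT.eigenvalues rfl i) * inner ℂ w y := by
    have h2 : inner ℂ w (T y) = hT.eigenvalues rfl i * inner ℂ w y := by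
      rw [← hT w y, hT.apply_eigenvectorBasis rfl i, inner_smul_left]
      simp [w]
    rw [← hy, inner_sub_right, inner_smul_right, h2, sub_mul]
  rw [eq_div_iff hne]
  have h3 : inner ℂ u w * inner ℂ w u = ((‖inner ℂ w u‖ ^ 2 : ℝ) : ℂ) := by
    rw [← inner_conj_symm u w, Complex.conj_mul']
    push_cast
    rfl
  rw [← h3, h1]
  ring

/-- The Schur complement of a vector state: with `v` a unit vector and `T` symmetric, the function
`z - 1 / ⟪v, (z - T)⁻¹ v⟫` is the sum of a real constant and a Cauchy transform. -/
lemma exists_sub_one_div_inner_eq_sum {E : Type*} [NormedAddCommGroup E] [InnerProductSpace ℂ E]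
    [FiniteDimensional ℂ E] {T : E →ₗ[ℂ] E} (hT : T.IsSymmetric) {v : E} (hv : ‖v‖ = 1) :
    ∃ (n : ℕ) (b : ℝ) (c t : Fin n → ℝ), (∀ i, 0 ≤ c i) ∧
      ∀ z : ℂ, 0 < z.im → ∀ x : E, z • x - T x = v → inner ℂ v x ≠ 0 →
        z - 1 / inner ℂ v x = b + ∑ i, (c i : ℂ) / (z - t i) := by
  have hvv : inner ℂ v v = (1 : ℂ) := by rw [inner_self_eq_norm_sq_to_K, hv]; simp
  -- `P` is the orthogonal projection onto the complement of `v`; the compression `PTP` supplies the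
  -- nodes.
  set P : E →ₗ[ℂ] E := LinearMap.id - (innerₛₗ ℂ v).smulRight v with hP
  have hPa : ∀ w, P w = w - inner ℂ v w • v := fun w => by simp [hP]
  have hPsymm : P.IsSymmetric := by
    intro a b
    rw [hPa, hPa, inner_sub_left, inner_sub_right, inner_smul_left, inner_smul_right,
      inner_conj_symm]
    ring
  have hB : (P ∘ₗ T ∘ₗ P).IsSymmetric := by
    intro a b
    simp only [LinearMap.comp_apply]
    rw [hPsymm, hT, hPsymm]
  obtain ⟨n, c, t, hc, -, h⟩ := exists_inner_eq_sum_of_isSymmetric hB (P (T v))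
  have hb : inner ℂ v (T v) = ((inner ℂ v (T v)).re : ℂ) := by
    refine (Complex.conj_eq_iff_re.1 ?_).symm
    rw [inner_conj_symm, hT]
  set b : ℝ := (inner ℂ v (T v)).re
  refine ⟨n, b, c, t, hc, fun z hz x hx hg => ?_⟩
  set g := inner ℂ v x with hgdef
  -- Rescaling `x` to have `v`-component `v` and removing that component gives a vector orthogonal
  -- to `v` that solves `(z - PTP) y = P T v`.
  set y := g⁻¹ • x - v with hy
  have hvy : inner ℂ v y = (0 : ℂ) := by
    rw [hy, inner_sub_right, inner_smul_right, hvv, ← hgdef, inv_mul_cancel₀ hg, sub_self]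
  have hTx : T x = z • x - v := by rw [← hx]; abel
  have hTy : T y = g⁻¹ • (z • x - v) - T v := by rw [hy, map_sub, map_smul, hTx]
  have hvTy : inner ℂ v (T y) = z - g⁻¹ - b := by
    rw [hTy, inner_sub_right, inner_smul_right, inner_sub_right, inner_smul_right, hvv, hb,
      ← hgdef]
    field_simp
  have hPy : P y = y := by rw [hPa, hvy, zero_smul, sub_zero]
  have hres : z • y - (P ∘ₗ T ∘ₗ P) y = P (T v) := by
    simp only [LinearMap.comp_apply]
    rw [hPy, hPa (T y), hPa (T v), hvTy, hb, hTy, hy]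
    module
  rw [← h z hz y hres, hPsymm, hPy, hT, hvTy]
  ring

/-! ### Rational Nevanlinna functions -/

/-- `k` coincides on the upper half-plane with a real constant plus the Cauchy transform of a
finitely supported positive measure. -/
def IsRationalK (k : ℂ → ℂ) : Prop :=
  ∃ (ι : Type) (_ : Fintype ι) (b : ℝ) (c t : ι → ℝ), (∀ i, 0 ≤ c i) ∧
    ∀ z : ℂ, 0 < z.im → k z = b + ∑ i, (c i : ℂ) / (z - t i)

/-- The Cauchy transform of `μ` is that of a finitely supported probability measure. -/
def HasRationalG (μ : ProbabilityMeasure ℝ) : Prop :=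
  ∃ (ι : Type) (_ : Fintype ι) (p a : ι → ℝ), (∀ i, 0 ≤ p i) ∧ ∑ i, p i = 1 ∧
    ∀ z : ℂ, 0 < z.im → cauchyTransform μ z = ∑ i, (p i : ℂ) / (z - a i)

lemma isRationalK_const (b : ℝ) : IsRationalK fun _ => b :=
  ⟨Empty, inferInstance, b, fun _ => 0, fun _ => 0, fun _ => le_rfl, fun z _ => by simp⟩

lemma IsRationalK.congr {k l : ℂ → ℂ} (hk : IsRationalK k) (h : ∀ z : ℂ, 0 < z.im → l z = k z) :
    IsRationalK l := by
  obtain ⟨ι, hι, b, c, t, hc, hk⟩ := hk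
  exact ⟨ι, hι, b, c, t, hc, fun z hz => (h z hz).trans (hk z hz)⟩

lemma IsRationalK.add {k l : ℂ → ℂ} (hk : IsRationalK k) (hl : IsRationalK l) :
    IsRationalK fun z => k z + l z := by
  obtain ⟨ι, hι, b, c, t, hc, hk⟩ := hk
  obtain ⟨ι', hι', b', c', t', hc', hl⟩ := hl
  refine ⟨ι ⊕ ι', inferInstance, b + b', Sum.elim c c', Sum.elim t t', ?_, fun z hz => ?_⟩
  · rintro (i | i)
    · exact hc i
    · exact hc' i
  · beta_reduce
    rw [hk z hz, hl z hz, Fintype.sum_sum_type]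
    simp only [Sum.elim_inl, Sum.elim_inr]
    push_cast
    ring

lemma IsRationalK.sum {J : Type*} (s : Finset J) {k : J → ℂ → ℂ} (hk : ∀ j, IsRationalK (k j)) :
    IsRationalK fun z => ∑ j ∈ s, k j z := by
  classical
  induction s using Finset.induction_on with
  | empty => simpa using isRationalK_const 0
  | insert j s hj ih => simpa only [Finset.sum_insert hj] using (hk j).add ih

lemma HasRationalG.isRationalK_mul {μ : ProbabilityMeasure ℝ} (hμ : HasRationalG μ) {r : ℝ}
    (hr : 0 ≤ r) : IsRationalK fun z => r * cauchyTransform μ z := by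
  obtain ⟨ι, hι, p, a, hp, -, h⟩ := hμ
  refine ⟨ι, hι, 0, fun i => r * p i, a, fun i => mul_nonneg hr (hp i), fun z hz => ?_⟩
  beta_reduce
  rw [h z hz, Finset.mul_sum]
  simp [mul_div_assoc]

lemma IsRationalK.im_nonpos {k : ℂ → ℂ} (hk : IsRationalK k) {z : ℂ} (hz : 0 < z.im) :
    (k z).im ≤ 0 := by
  obtain ⟨ι, hι, b, c, t, hc, hk⟩ := hk
  rw [hk z hz, Complex.add_im, Complex.ofReal_im, zero_add, Complex.im_sum]
  refine Finset.sum_nonpos fun i _ => ?_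
  rw [div_eq_mul_one_div, Complex.im_ofReal_mul, im_resolvent]
  have := mul_nonneg hz.le (sq_nonneg ‖1 / (z - (t i : ℂ))‖)
  nlinarith [hc i]

/-- The sum `∑ p_i / (z - a_i)` is the Cauchy transform of `∑ p_i δ_{a_i}`. -/
lemma exists_cauchyTransform_eq_sum {ι : Type} [Fintype ι] {p a : ι → ℝ} (hp : ∀ i, 0 ≤ p i)
    (hsum : ∑ i, p i = 1) :
    ∃ μ : ProbabilityMeasure ℝ, ∀ z : ℂ, cauchyTransform μ z = ∑ i, (p i : ℂ) / (z - a i) := by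
  have hprob : IsProbabilityMeasure
      (∑ i, ENNReal.ofReal (p i) • Measure.dirac (a i) : Measure ℝ) := by
    constructor
    simp only [Measure.coe_finsetSum, Finset.sum_apply, Measure.smul_apply, measure_univ, smul_eq_mul,
      mul_one]
    rw [← ENNReal.ofReal_sum_of_nonneg fun i _ => hp i, hsum, ENNReal.ofReal_one]
  refine ⟨⟨_, hprob⟩, fun z => ?_⟩
  simp only [cauchyTransform, ProbabilityMeasure.coe_mk]
  rw [integral_finsetSum_measure]
  · refine Finset.sum_congr rfl fun i _ => ?_
    rw [integral_smul_measure, integral_dirac, ENNReal.toReal_ofReal (hp i), Complex.real_smul,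
      mul_one_div]
  · intro i _
    exact (integrable_dirac (by simp)).smul_measure ENNReal.ofReal_ne_top

/-- `G(z) = ⟪v, (z - A)⁻¹ v⟫` for `A = diag(a_i)` and the unit vector `v = (√p_i)`, so `z - 1/G` is
the Schur complement of `exists_sub_one_div_inner_eq_sum`. -/
lemma HasRationalG.isRationalK {μ : ProbabilityMeasure ℝ} (hμ : HasRationalG μ) :
    IsRationalK (kTransform μ) := by
  classical
  obtain ⟨ι, hι, p, a, hp, hsum, h⟩ := hμ
  set A : Matrix ι ι ℂ := Matrix.diagonal fun i => (a i : ℂ) with hA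
  have hAh : A.IsHermitian := by
    rw [hA, Matrix.isHermitian_diagonal_iff]
    intro i
    simp [isSelfAdjoint_iff]
  have hT := Matrix.isSymmetric_toEuclideanLin_iff.2 hAh
  set v : EuclideanSpace ℂ ι := WithLp.toLp 2 fun i => ((√(p i) : ℝ) : ℂ) with hvdef
  have hv : ‖v‖ = 1 := by
    rw [EuclideanSpace.norm_eq, hvdef, Real.sqrt_eq_one, ← hsum]
    refine Finset.sum_congr rfl fun i _ => ?_
    rw [Complex.norm_real, Real.norm_eq_abs, sq_abs, Real.sq_sqrt (hp i)]
  obtain ⟨n, b, c, t, hc, hmain⟩ := exists_sub_one_div_inner_eq_sum hT hv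
  refine ⟨Fin n, inferInstance, b, c, t, hc, fun z hz => ?_⟩
  set x : EuclideanSpace ℂ ι := WithLp.toLp 2 fun i => ((√(p i) : ℝ) : ℂ) / (z - a i) with hxdef
  have hx : z • x - Matrix.toEuclideanLin A x = v := by
    ext i
    have hne := sub_ofReal_ne_zero hz.ne' (a i)
    simp only [hxdef, hvdef, hA, PiLp.sub_apply, PiLp.smul_apply, smul_eq_mul,
      Matrix.toLpLin_apply, Matrix.mulVec_diagonal]
    field_simp
  have hinner : inner ℂ v x = cauchyTransform μ z := by
    rw [h z hz, PiLp.inner_apply]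
    refine Finset.sum_congr rfl fun i _ => ?_
    have : (p i : ℂ) = ((√(p i) : ℝ) : ℂ) * ((√(p i) : ℝ) : ℂ) := by
      rw [← Complex.ofReal_mul, Real.mul_self_sqrt (hp i)]
    simp only [hxdef, hvdef, RCLike.inner_apply, Complex.conj_ofReal]
    rw [this]
    ring
  have := hmain z hz x hx (by rw [hinner]; exact cauchyTransform_ne_zero μ hz.ne')
  rw [hinner] at this
  exact this

/-- Take the Hermitian matrix with corner `b`, border `√c_i` and remaining diagonal `t_i`: by block
inversion the corner entry of its resolvent is `1 / (z - k(z))`, and the spectral theorem makes that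
a Cauchy transform. -/
lemma IsRationalK.exists_hasRationalG {k : ℂ → ℂ} (hk : IsRationalK k) :
    ∃ μ : ProbabilityMeasure ℝ, HasRationalG μ ∧
      ∀ z : ℂ, 0 < z.im → cauchyTransform μ z = 1 / (z - k z) := by
  classical
  have him : ∀ z : ℂ, 0 < z.im → z - k z ≠ 0 := by
    intro z hz h0
    have h1 := hk.im_nonpos hz
    have h2 := congrArg Complex.im h0
    rw [Complex.sub_im, Complex.zero_im] at h2
    linarith
  obtain ⟨ι, hι, b, c, t, hc, hk⟩ := hk
  set A : Matrix (Option ι) (Option ι) ℂ := Matrix.of fun i j =>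
    match i, j with
    | none, none => (b : ℂ)
    | none, some j => ((√(c j) : ℝ) : ℂ)
    | some i, none => ((√(c i) : ℝ) : ℂ)
    | some i, some j => if i = j then (t i : ℂ) else 0 with hA
  have hAh : A.IsHermitian := by
    refine Matrix.IsHermitian.ext fun i j => ?_
    rcases i with _ | i <;> rcases j with _ | j
    · simp [hA]
    · simp [hA]
    · simp [hA]
    · simp only [hA, Matrix.of_apply]
      by_cases hij : i = j
      · subst hij
        simp
      · simp [hij, Ne.symm hij]
  have hT := Matrix.isSymmetric_toEuclideanLin_iff.2 hAh
  set e : EuclideanSpace ℂ (Option ι) := EuclideanSpace.single none 1 with he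
  obtain ⟨n, p, a, hp, hsum, hmain⟩ := exists_inner_eq_sum_of_isSymmetric hT e
  have hsum' : ∑ i, p i = 1 := by rw [hsum, he]; simp
  obtain ⟨μ, hμ⟩ := exists_cauchyTransform_eq_sum (a := a) hp hsum'
  refine ⟨μ, ⟨Fin n, inferInstance, p, a, hp, hsum', fun z _ => hμ z⟩, fun z hz => ?_⟩
  -- The column of the resolvent indexed by `none`.
  set x : EuclideanSpace ℂ (Option ι) := WithLp.toLp 2 fun o =>
    match o with
    | none => 1 / (z - k z)
    | some i => ((√(c i) : ℝ) : ℂ) / (z - t i) * (1 / (z - k z)) with hxdef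
  have hx : z • x - Matrix.toEuclideanLin A x = e := by
    ext o
    simp only [PiLp.sub_apply, PiLp.smul_apply, smul_eq_mul, Matrix.toLpLin_apply,
      Matrix.mulVec, dotProduct, Fintype.sum_option]
    rcases o with _ | i
    · simp only [hxdef, hA, he, Matrix.of_apply, PiLp.single_apply, if_true]
      have h1 : ∑ i, ((√(c i) : ℝ) : ℂ) * (((√(c i) : ℝ) : ℂ) / (z - t i) * (1 / (z - k z))) =
          (k z - b) * (1 / (z - k z)) := by
        rw [hk z hz, add_sub_cancel_left, Finset.sum_mul]
        refine Finset.sum_congr rfl fun i _ => ?_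
        have : (c i : ℂ) = ((√(c i) : ℝ) : ℂ) * ((√(c i) : ℝ) : ℂ) := by
          rw [← Complex.ofReal_mul, Real.mul_self_sqrt (hc i)]
        rw [this]
        ring
      rw [h1]
      have := him z hz
      field_simp
      ring
    · have hne := sub_ofReal_ne_zero hz.ne' (t i)
      simp only [hxdef, hA, he, Matrix.of_apply, PiLp.single_apply, ite_mul, zero_mul,
        Finset.sum_ite_eq, Finset.mem_univ, if_true, reduceCtorEq, if_false]
      field_simp
      ring
  rw [hμ, ← hmain z hz x hx, he, EuclideanSpace.inner_single_left]
  simp [hxdef]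

/-- Each term `c / (z - K_ν(z) - t)` is `c` times `1 / (z - (K_ν(z) + t))`. As `K_ν + t` is again
rational of this type, the latter is the Cauchy transform of a finitely supported measure. -/
lemma IsRationalK.comp_sub_kTransform {k : ℂ → ℂ} (hk : IsRationalK k) {ν : ProbabilityMeasure ℝ}
    (hν : HasRationalG ν) : IsRationalK fun z => k (z - kTransform ν z) := by
  obtain ⟨ι, hι, b, c, t, hc, hk⟩ := hk
  have h1 : ∀ i, IsRationalK fun z => (c i : ℂ) / ((z - kTransform ν z) - t i) := by
    intro i
    obtain ⟨lam, hlam, hG⟩ := (hν.isRationalK.add (isRationalK_const (t i))).exists_hasRationalG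
    refine (hlam.isRationalK_mul (hc i)).congr fun z hz => ?_
    rw [hG z hz, mul_one_div, sub_sub]
  refine ((isRationalK_const b).add (IsRationalK.sum Finset.univ h1)).congr fun z hz => ?_
  exact hk _ (im_sub_kTransform_pos ν hz)

lemma exists_kTransform_eq_sum_of_hasRationalG {J : Type*} [Fintype J]
    {μ ν : J → ProbabilityMeasure ℝ} (hμ : ∀ j, HasRationalG (μ j)) (hν : ∀ j, HasRationalG (ν j)) :
    ∃ lam : ProbabilityMeasure ℝ, ∀ z : ℂ, 0 < z.im →
      kTransform lam z = ∑ j, kTransform (μ j) (z - kTransform (ν j) z) := by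
  obtain ⟨lam, -, h⟩ := (IsRationalK.sum Finset.univ fun j =>
    (hμ j).isRationalK.comp_sub_kTransform (hν j)).exists_hasRationalG
  exact ⟨lam, fun z hz => kTransform_eq_of_cauchyTransform_eq (h z hz)⟩

/-! ### The one-step convolution of arbitrary measures -/

/-- Push `μ` forward by simple functions `f n` converging to the identity. The bound `|f n t| ≤
2|t|` accounts for the factor in `2 * y` and makes the moment control uniform in `n`, as needed for
compactness. -/
lemma exists_approx_hasRationalG (μ : ProbabilityMeasure ℝ) :
    ∃ ν : ℕ → ProbabilityMeasure ℝ, (∀ n, HasRationalG (ν n)) ∧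
      (∀ z : ℂ, 0 < z.im →
        Tendsto (fun n => cauchyTransform (ν n) z) atTop (𝓝 (cauchyTransform μ z))) ∧
      ∀ (n : ℕ) (y : ℝ), 0 < y → truncMoment (ν n) (2 * y) ≤ truncMoment μ y := by
  set f : ℕ → SimpleFunc ℝ ℝ := fun n =>
    SimpleFunc.approxOn id measurable_id Set.univ 0 (Set.mem_univ _) n with hf
  have hlim : ∀ t, Tendsto (fun n => f n t) atTop (𝓝 t) := fun t =>
    SimpleFunc.tendsto_approxOn measurable_id (Set.mem_univ _) (by simp)
  have hbd : ∀ n t, |f n t| ≤ 2 * |t| := by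
    intro n t
    have := SimpleFunc.norm_approxOn_zero_le measurable_id (Set.mem_univ (0 : ℝ)) t n
    simp only [id, Real.norm_eq_abs] at this
    linarith
  have hmap : ∀ n, AEMeasurable (f n) (μ : Measure ℝ) := fun n => (f n).measurable.aemeasurable
  have hG : ∀ (n : ℕ) (z : ℂ), z.im ≠ 0 → cauchyTransform (μ.map (hmap n)) z =
      ∫ t : ℝ, 1 / (z - (f n t : ℂ)) ∂(μ : Measure ℝ) := by
    intro n z hz
    rw [cauchyTransform, ProbabilityMeasure.toMeasure_map]
    exact integral_map (hmap n) (resolventFun z hz).continuous.aestronglyMeasurable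
  refine ⟨fun n => μ.map (hmap n), fun n => ?_, fun z hz => ?_, fun n y hy => ?_⟩
  · refine ⟨{x // x ∈ (f n).range}, inferInstance,
      fun x => (μ : Measure ℝ).real (f n ⁻¹' {x.1}), fun x => x.1,
      fun x => measureReal_nonneg, ?_, fun z hz => ?_⟩
    · rw [Finset.sum_coe_sort (f n).range fun x => (μ : Measure ℝ).real (f n ⁻¹' {x})]
      have h1 := (f n).sum_range_measure_preimage_singleton (μ : Measure ℝ)
      simp only [measureReal_def]
      rw [← ENNReal.toReal_sum fun x _ => measure_ne_top _ _, h1]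
      simp
    · rw [hG n z hz.ne']
      have h1 : ∀ t : ℝ, 1 / (z - (f n t : ℂ)) = ∑ x : {x // x ∈ (f n).range},
          (f n ⁻¹' {x.1}).indicator (fun _ => 1 / (z - (x.1 : ℂ))) t := by
        intro t
        rw [Finset.sum_eq_single ⟨f n t, SimpleFunc.mem_range_self _ t⟩]
        · simp
        · intro x _ hx
          refine Set.indicator_of_notMem (fun h => hx (Subtype.ext ?_)) _
          exact (Set.mem_singleton_iff.1 h).symm
        · simp
      simp only [h1]
      rw [integral_finsetSum _ fun x _ =>
        (integrable_const _).indicator ((f n).measurableSet_preimage _)]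
      refine Finset.sum_congr rfl fun x _ => ?_
      rw [integral_indicator_const _ ((f n).measurableSet_preimage _), Complex.real_smul,
        mul_one_div]
  · simp only [hG _ z hz.ne']
    refine tendsto_integral_of_dominated_convergence (fun _ => 1 / |z.im|) (fun n => ?_)
      (integrable_const _) (fun n => Eventually.of_forall fun t => norm_one_div_sub_le hz.ne' _)
      (Eventually.of_forall fun t => ?_)
    · exact ((resolventFun z hz.ne').continuous.measurable.comp
        (f n).measurable).aestronglyMeasurable
    · exact ((resolventFun z hz.ne').continuous.tendsto t).comp (hlim t)
  · have h2y : 0 < 2 * y := by positivity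
    have h1 : truncMoment (μ.map (hmap n)) (2 * y) =
        ∫ t : ℝ, min 1 (|f n t| / (2 * y)) ∂(μ : Measure ℝ) := by
      rw [truncMoment, ProbabilityMeasure.toMeasure_map]
      exact integral_map (hmap n) (truncFun (2 * y) h2y).continuous.aestronglyMeasurable
    rw [h1]
    refine integral_mono_of_nonneg (Eventually.of_forall fun t => by positivity)
      (integrable_trunc μ hy) (Eventually.of_forall fun t => ?_)
    have h3 : |f n t| / (2 * y) ≤ |t| / y := by
      calc |f n t| / (2 * y) ≤ 2 * |t| / (2 * y) := by gcongr; exact hbd n t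
        _ = |t| / y := by field_simp
    exact min_le_min le_rfl h3

theorem exists_kTransform_eq_sum {J : Type*} [Fintype J] (μ ν : J → ProbabilityMeasure ℝ) :
    ∃ lam : ProbabilityMeasure ℝ, ∀ z : ℂ, 0 < z.im →
      kTransform lam z = ∑ j, kTransform (μ j) (z - kTransform (ν j) z) := by
  choose μ' hμ hμG hμτ using fun j => exists_approx_hasRationalG (μ j)
  choose ν' hν hνG hντ using fun j => exists_approx_hasRationalG (ν j)
  choose lam hlam using fun n => exists_kTransform_eq_sum_of_hasRationalG
    (fun j => hμ j n) (fun j => hν j n)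
  obtain ⟨lam₀, φ, hφ, hconv⟩ := exists_subseq_tendsto (μ := lam) (by
    intro ε hε
    -- At height `2y` each `K` is at most `12 · 2y · δ`. The first bound makes this at most `y`, so
    -- the shifted argument stays in the disc; the second bounds the sum over `J` by `ε · 2y`, with
    -- `+ 1` covering empty `J`.
    set δ : ℝ := min (1 / 24) (ε / (12 * (Fintype.card J + 1))) with hδ
    have hδpos : 0 < δ := by positivity
    have hev : ∀ᶠ y in atTop, ∀ j, truncMoment (μ j) y ≤ δ ∧ truncMoment (ν j) y ≤ δ :=
      eventually_all.2 fun j =>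
        (((tendsto_truncMoment_atTop (μ j)).eventually (ge_mem_nhds hδpos)).and
          ((tendsto_truncMoment_atTop (ν j)).eventually (ge_mem_nhds hδpos)))
    obtain ⟨y, hy, hy0⟩ := (hev.and (eventually_gt_atTop 0)).exists
    have h2y : 0 < 2 * y := by positivity
    refine ⟨2 * y, h2y, fun n => ?_⟩
    have hδ1 : δ ≤ 1 / 24 := min_le_left _ _
    rw [hlam n _ (mul_I_im_pos h2y)]
    have hterm : ∀ j, ‖kTransform (μ' j n) ((2 * y : ℝ) * I -
        kTransform (ν' j n) ((2 * y : ℝ) * I))‖ ≤ 12 * (2 * y) * δ := by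
      intro j
      have h1 := (hντ j n y hy0).trans (hy j).2
      have h2 := (hμτ j n y hy0).trans (hy j).1
      have h3 : ‖kTransform (ν' j n) ((2 * y : ℝ) * I)‖ ≤ 2 * y / 2 := by
        refine (norm_kTransform_le _ h2y (norm_ofReal_mul_I_sub_self_le h2y) (by linarith)).trans ?_
        nlinarith
      refine (norm_kTransform_le _ h2y (by rwa [sub_sub_cancel_left, norm_neg])
        (by linarith)).trans ?_
      gcongr
    refine (norm_sum_le_of_le _ fun j _ => hterm j).trans ?_
    rw [Finset.sum_const, Finset.card_univ, nsmul_eq_mul]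
    have h4 : δ ≤ ε / (12 * (Fintype.card J + 1)) := min_le_right _ _
    rw [le_div_iff₀ (by positivity)] at h4
    nlinarith)
  refine ⟨lam₀, fun z hz => ?_⟩
  have h1 : Tendsto (fun n => kTransform (lam (φ n)) z) atTop (𝓝 (kTransform lam₀ z)) :=
    tendsto_kTransform hz hconv tendsto_const_nhds
  refine tendsto_nhds_unique h1 ?_
  simp only [hlam _ z hz]
  refine tendsto_finsetSum _ fun j _ => ?_
  refine tendsto_kTransform_of_cauchyTransform (im_sub_kTransform_pos _ hz)
    ((hμG j _ (im_sub_kTransform_pos _ hz)).comp hφ.tendsto_atTop) (tendsto_const_nhds.sub ?_)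
  exact tendsto_kTransform_of_cauchyTransform hz ((hνG j z hz).comp hφ.tendsto_atTop)
    tendsto_const_nhds

/-- A probability measure whose `K`-transform is `∑ j, K_{μ_j}(z - K_{ν_j}(z))`. -/
noncomputable def stepMeasure {J : Type*} [Fintype J] (μ ν : J → ProbabilityMeasure ℝ) :
    ProbabilityMeasure ℝ := (exists_kTransform_eq_sum μ ν).choose

lemma kTransform_stepMeasure {J : Type*} [Fintype J] (μ ν : J → ProbabilityMeasure ℝ) {z : ℂ}
    (hz : 0 < z.im) :
    kTransform (stepMeasure μ ν) z = ∑ j, kTransform (μ j) (z - kTransform (ν j) z) :=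
  (exists_kTransform_eq_sum μ ν).choose_spec z hz

/-! ### Convolution along the truncations of a tree -/

variable {N : ℕ}

open Classical in
/-- The convolution along the truncation at height `l` of a rooted tree. -/
noncomputable def truncConv : ℕ → RootedTree N → (Fin N → ProbabilityMeasure ℝ) →
    ProbabilityMeasure ℝ
  | 0, _, _ => ⟨Measure.dirac 0, inferInstance⟩
  | l + 1, T, μ => stepMeasure
      (fun j : {j : Fin N // AltString.letter j ∈ T.verts} => μ j.1)
      (fun j => truncConv l (T.branch j.1 j.2) μ)

lemma kTransform_truncConv_zero (T : RootedTree N) (μ : Fin N → ProbabilityMeasure ℝ) (z : ℂ) :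
    kTransform (truncConv 0 T μ) z = 0 := by
  simp [kTransform, fTransform, cauchyTransform, truncConv]

open Classical in
lemma kTransform_truncConv_succ (l : ℕ) (T : RootedTree N) (μ : Fin N → ProbabilityMeasure ℝ)
    {z : ℂ} (hz : 0 < z.im) :
    kTransform (truncConv (l + 1) T μ) z =
      ∑ j : {j : Fin N // AltString.letter j ∈ T.verts},
        kTransform (μ j.1) (z - kTransform (truncConv l (T.branch j.1 j.2) μ) z) :=
  kTransform_stepMeasure _ _ hz

lemma sum_subtype_le_sum (p : Fin N → Prop) [Fintype {j // p j}] {f : Fin N → ℝ}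
    (hf : ∀ j, 0 ≤ f j) : ∑ j : {j // p j}, f j ≤ ∑ j, f j := by
  classical
  rw [← Fintype.sum_subtype_add_sum_subtype p f]
  have : 0 ≤ ∑ j : {j // ¬ p j}, f j := Finset.sum_nonneg fun j _ => hf j
  convert! le_add_of_nonneg_right this

/-- The sum of the truncated absolute moments of several measures. -/
noncomputable def totalMoment (μ : Fin N → ProbabilityMeasure ℝ) (y : ℝ) : ℝ :=
  ∑ j, truncMoment (μ j) y

lemma totalMoment_nonneg (μ : Fin N → ProbabilityMeasure ℝ) {y : ℝ} (hy : 0 < y) :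
    0 ≤ totalMoment μ y := Finset.sum_nonneg fun _ _ => truncMoment_nonneg _ hy

lemma truncMoment_le_totalMoment (μ : Fin N → ProbabilityMeasure ℝ) {y : ℝ} (hy : 0 < y)
    (j : Fin N) : truncMoment (μ j) y ≤ totalMoment μ y :=
  Finset.single_le_sum (f := fun j => truncMoment (μ j) y)
    (fun _ _ => truncMoment_nonneg _ hy) (Finset.mem_univ j)

lemma tendsto_totalMoment_atTop (μ : Fin N → ProbabilityMeasure ℝ) :
    Tendsto (totalMoment μ) atTop (𝓝 0) := by
  have := tendsto_finsetSum Finset.univ fun j _ => tendsto_truncMoment_atTop (μ j)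
  simpa only [Finset.sum_const_zero] using! this

lemma totalMoment_antitone (μ : Fin N → ProbabilityMeasure ℝ) {x y : ℝ} (hx : 0 < x)
    (hxy : x ≤ y) : totalMoment μ y ≤ totalMoment μ x :=
  Finset.sum_le_sum fun _ _ => truncMoment_antitone _ hx hxy

lemma continuous_totalMoment {y : ℝ} (hy : 0 < y) :
    Continuous fun μ : Fin N → ProbabilityMeasure ℝ => totalMoment μ y :=
  continuous_finsetSum _ fun j _ => (continuous_truncMoment hy).comp (continuous_apply j)

/-- The bound reproduces itself: being at most `y/2`, it keeps the shifted argument in the disc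
where `norm_kTransform_le` applies, and summing over the letters present returns the same bound. -/
lemma norm_kTransform_truncConv_le {μ : Fin N → ProbabilityMeasure ℝ} {y : ℝ} (hy : 0 < y)
    (h : 136 * totalMoment μ y ≤ 1 / 2) (l : ℕ) (T : RootedTree N) :
    ‖kTransform (truncConv l T μ) (y * I)‖ ≤ 12 * y * totalMoment μ y := by
  classical
  have h0 := totalMoment_nonneg μ hy
  induction l generalizing T with
  | zero =>
    rw [kTransform_truncConv_zero, norm_zero]
    positivity
  | succ l ih =>
    rw [kTransform_truncConv_succ l T μ (mul_I_im_pos hy)]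
    refine (norm_sum_le_of_le _ fun j _ => norm_kTransform_le (y := y) (μ j.1) hy ?_ ?_).trans ?_
    · rw [sub_sub_cancel_left, norm_neg]
      refine (ih (T.branch j.1 j.2)).trans ?_
      nlinarith
    · linarith [truncMoment_le_totalMoment μ hy j.1]
    · rw [totalMoment, Finset.mul_sum]
      exact sum_subtype_le_sum _ (f := fun j => 12 * y * truncMoment (μ j) y)
        fun j => mul_nonneg (by positivity) (truncMoment_nonneg _ hy)

lemma norm_kTransform_truncConv_le_half {μ : Fin N → ProbabilityMeasure ℝ} {y : ℝ} (hy : 0 < y)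
    (h : 136 * totalMoment μ y ≤ 1 / 2) (l : ℕ) (T : RootedTree N) :
    ‖kTransform (truncConv l T μ) (y * I)‖ ≤ y / 2 := by
  refine (norm_kTransform_truncConv_le hy h l T).trans ?_
  nlinarith [totalMoment_nonneg μ hy]

/-- The Lipschitz constants over all letters sum to at most `1/2`, so each level of the recursion
halves the difference, whatever the tree. -/
lemma dist_kTransform_truncConv_succ_le {μ : Fin N → ProbabilityMeasure ℝ} {y : ℝ} (hy : 0 < y)
    (h : 136 * totalMoment μ y ≤ 1 / 2) (T : RootedTree N) (l : ℕ) :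
    dist (kTransform (truncConv l T μ) (y * I)) (kTransform (truncConv (l + 1) T μ) (y * I)) ≤
      y * (1 / 2) ^ l := by
  classical
  induction l generalizing T with
  | zero =>
    rw [kTransform_truncConv_zero, dist_zero_left, pow_zero, mul_one]
    linarith [norm_kTransform_truncConv_le_half hy h (0 + 1) T]
  | succ l ih =>
    have him := mul_I_im_pos hy
    rw [dist_eq_norm, kTransform_truncConv_succ (l + 1) T μ him,
      kTransform_truncConv_succ l T μ him, ← Finset.sum_sub_distrib]
    have hterm : ∀ j : {j : Fin N // AltString.letter j ∈ T.verts},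
        ‖kTransform (μ j.1) (y * I - kTransform (truncConv l (T.branch j.1 j.2) μ) (y * I)) -
          kTransform (μ j.1) (y * I - kTransform (truncConv (l + 1) (T.branch j.1 j.2) μ) (y * I))‖ ≤
        136 * truncMoment (μ j.1) y * (y * (1 / 2) ^ l) := by
      intro j
      have hτ := truncMoment_nonneg (μ j.1) hy
      refine (norm_kTransform_sub_le (y := y) (μ j.1) hy ?_ ?_ ?_).trans ?_
      · rw [sub_sub_cancel_left, norm_neg]
        exact norm_kTransform_truncConv_le_half hy h _ _
      · rw [sub_sub_cancel_left, norm_neg]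
        exact norm_kTransform_truncConv_le_half hy h _ _
      · linarith [truncMoment_le_totalMoment μ hy j.1]
      · rw [sub_sub_sub_cancel_left, ← dist_eq_norm, dist_comm]
        gcongr
        exact ih (T.branch j.1 j.2)
    refine (norm_sum_le_of_le _ fun j _ => hterm j).trans ?_
    refine (sum_subtype_le_sum _ (f := fun j => 136 * truncMoment (μ j) y * (y * (1 / 2) ^ l))
      fun j => by have := truncMoment_nonneg (μ j) hy; positivity).trans ?_
    rw [← Finset.sum_mul, ← Finset.mul_sum]
    calc 136 * totalMoment μ y * (y * (1 / 2) ^ l) ≤ 1 / 2 * (y * (1 / 2) ^ l) := by gcongr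
      _ = y * (1 / 2) ^ (l + 1) := by ring

lemma exists_totalMoment_lt (μ : Fin N → ProbabilityMeasure ℝ) {ε : ℝ} (hε : 0 < ε) :
    ∃ y₀ : ℝ, 0 < y₀ ∧ 136 * totalMoment μ y₀ < 1 / 2 ∧ 12 * totalMoment μ y₀ ≤ ε := by
  have h1 := (tendsto_totalMoment_atTop μ).eventually
    (gt_mem_nhds (show (0 : ℝ) < min (1 / 272) (ε / 12) by positivity))
  obtain ⟨y, hy, hy0⟩ := (h1.and (eventually_gt_atTop 0)).exists
  obtain ⟨h2, h3⟩ := lt_min_iff.1 hy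
  exact ⟨y, hy0, by linarith, by linarith⟩

lemma exists_tendsto_truncConv (T : RootedTree N) (μ : Fin N → ProbabilityMeasure ℝ) :
    ∃ lam : ProbabilityMeasure ℝ, Tendsto (fun l => truncConv l T μ) atTop (𝓝 lam) := by
  obtain ⟨lam, φ, hφ, hconv⟩ := exists_subseq_tendsto (μ := fun l => truncConv l T μ) (by
    intro ε hε
    obtain ⟨y, hy, h1, h2⟩ := exists_totalMoment_lt μ hε
    refine ⟨y, hy, fun l => (norm_kTransform_truncConv_le hy h1.le l T).trans ?_⟩
    nlinarith)
  obtain ⟨y₀, hy₀, h0, -⟩ := exists_totalMoment_lt μ one_pos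
  refine ⟨lam, tendsto_of_tendsto_cauchyTransform hy₀ fun y hy => ?_⟩
  have hy' := hy₀.trans_le hy
  have hgood : 136 * totalMoment μ y ≤ 1 / 2 := by linarith [totalMoment_antitone μ hy₀ hy]
  refine tendsto_cauchyTransform_of_kTransform (mul_I_im_pos hy') ?_
  -- Compactness supplies a limit measure along a subsequence; the contraction at each high `iy`
  -- extends the convergence to the whole sequence.
  refine tendsto_nhds_of_cauchySeq_of_subseq (cauchySeq_of_le_geometric (1 / 2) y (by norm_num)
    (dist_kTransform_truncConv_succ_le hy' hgood T)) hφ.tendsto_atTop ?_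
  exact tendsto_kTransform (mul_I_im_pos hy') hconv tendsto_const_nhds

/-! ### Convolution along a rooted tree -/

/-- The convolution of the measures `μ_1, …, μ_N` along a rooted tree. -/
noncomputable def treeConv (T : RootedTree N) (μ : Fin N → ProbabilityMeasure ℝ) :
    ProbabilityMeasure ℝ := (exists_tendsto_truncConv T μ).choose

lemma tendsto_truncConv (T : RootedTree N) (μ : Fin N → ProbabilityMeasure ℝ) :
    Tendsto (fun l => truncConv l T μ) atTop (𝓝 (treeConv T μ)) :=
  (exists_tendsto_truncConv T μ).choose_spec

lemma tendsto_kTransform_truncConv (T : RootedTree N) (μ : Fin N → ProbabilityMeasure ℝ) {z : ℂ}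
    (hz : 0 < z.im) :
    Tendsto (fun l => kTransform (truncConv l T μ) z) atTop (𝓝 (kTransform (treeConv T μ) z)) :=
  tendsto_kTransform hz (tendsto_truncConv T μ) tendsto_const_nhds

lemma satisfiesFixedPointEquation_treeConv :
    SatisfiesFixedPointEquation (treeConv (N := N)) := by
  intro T μ z hz
  refine tendsto_nhds_unique ((tendsto_add_atTop_iff_nat 1).2
    (tendsto_kTransform_truncConv T μ hz)) ?_
  simp only [kTransform_truncConv_succ _ T μ hz]
  refine tendsto_finsetSum _ fun j _ => ?_
  exact tendsto_kTransform (im_sub_kTransform_pos _ hz) tendsto_const_nhds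
    (tendsto_const_nhds.sub (tendsto_kTransform_truncConv _ μ hz))

lemma dist_kTransform_truncConv_treeConv_le {μ : Fin N → ProbabilityMeasure ℝ} {y : ℝ}
    (hy : 0 < y) (h : 136 * totalMoment μ y ≤ 1 / 2) (T : RootedTree N) (l : ℕ) :
    dist (kTransform (truncConv l T μ) (y * I)) (kTransform (treeConv T μ) (y * I)) ≤
      2 * y * (1 / 2) ^ l := by
  refine (dist_le_of_le_geometric_of_tendsto (1 / 2) y (by norm_num)
    (dist_kTransform_truncConv_succ_le hy h T)
    (tendsto_kTransform_truncConv T μ (mul_I_im_pos hy)) l).trans (le_of_eq ?_)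
  ring

/-! ### Dependence on the tree -/

lemma letter_mem_iff_of_ball_eq {T T' : RootedTree N} {l : ℕ}
    (h : T.ball (l + 1) = T'.ball (l + 1)) (j : Fin N) :
    AltString.letter j ∈ T.verts ↔ AltString.letter j ∈ T'.verts := by
  have h1 := Set.ext_iff.1 h (AltString.letter j)
  have h2 : (AltString.letter j).1.length ≤ l + 1 := by simp [AltString.letter]
  simpa only [RootedTree.ball, Set.mem_ofPred_eq, h2, and_true] using h1

lemma branch_ball_eq {T T' : RootedTree N} {l : ℕ} (h : T.ball (l + 1) = T'.ball (l + 1))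
    {j : Fin N} (hj : AltString.letter j ∈ T.verts) (hj' : AltString.letter j ∈ T'.verts) :
    (T.branch j hj).ball l = (T'.branch j hj').ball l := by
  have key : ∀ {U U' : RootedTree N}, U.ball (l + 1) = U'.ball (l + 1) →
      ∀ (hU : AltString.letter j ∈ U.verts) (hU' : AltString.letter j ∈ U'.verts),
      (U.branch j hU).ball l ⊆ (U'.branch j hU').ball l := by
    rintro U U' hUU hU hU' s ⟨⟨t, ht, hts⟩, hs⟩
    have h1 : t ∈ U'.ball (l + 1) := hUU ▸ ⟨ht, by rw [hts]; simpa using hs⟩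
    exact ⟨⟨t, h1.1, hts⟩, hs⟩
  exact (key h hj hj').antisymm (key h.symm hj' hj)

/-- The two measures are chosen over different index types, so they are compared through their
`K`-transforms, which determine them. -/
lemma truncConv_eq_of_ball_eq (μ : Fin N → ProbabilityMeasure ℝ) {l : ℕ} {T T' : RootedTree N}
    (h : T.ball l = T'.ball l) : truncConv l T μ = truncConv l T' μ := by
  classical
  induction l generalizing T T' with
  | zero => rfl
  | succ l ih =>
    refine eq_of_kTransform_eq fun z hz => ?_
    rw [kTransform_truncConv_succ l T μ hz, kTransform_truncConv_succ l T' μ hz]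
    refine Fintype.sum_equiv (Equiv.subtypeEquivRight (letter_mem_iff_of_ball_eq h)) _ _ fun j => ?_
    rw [ih (branch_ball_eq h j.2 ((letter_mem_iff_of_ball_eq h j.1).1 j.2))]
    rfl

lemma tendsto_kTransform_truncConv_right {ι : Type*} {F : Filter ι}
    {μ : ι → Fin N → ProbabilityMeasure ℝ} {μ₀ : Fin N → ProbabilityMeasure ℝ}
    (hμ : Tendsto μ F (𝓝 μ₀)) (l : ℕ) (T : RootedTree N) {z : ℂ} (hz : 0 < z.im) :
    Tendsto (fun i => kTransform (truncConv l T (μ i)) z) F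
      (𝓝 (kTransform (truncConv l T μ₀) z)) := by
  classical
  induction l generalizing T with
  | zero =>
    simp only [kTransform_truncConv_zero]
    exact tendsto_const_nhds
  | succ l ih =>
    simp only [kTransform_truncConv_succ _ T _ hz]
    refine tendsto_finsetSum _ fun j _ => ?_
    exact tendsto_kTransform (im_sub_kTransform_pos _ hz) (tendsto_pi_nhds.1 hμ j.1)
      (tendsto_const_nhds.sub (ih (T.branch j.1 j.2)))

lemma ball_eq_of_dist_lt {T T' : RootedTree N} {l : ℕ} (h : dist T T' < Real.exp (-(l : ℝ))) :
    T.ball l = T'.ball l := by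
  by_cases hne : T = T'
  · rw [hne]
  · have h1 : T.rho T' < Real.exp (-(l : ℝ)) := h
    rw [RootedTree.rho, if_neg hne, Real.exp_lt_exp, neg_lt_neg_iff, Nat.cast_lt] at h1
    exact RootedTree.ball_eq_of_le h1.le (RootedTree.ball_sSup hne)

lemma dist_le_of_ball_eq {T T' : RootedTree N} {l : ℕ} (h : T.ball l = T'.ball l) :
    dist T T' ≤ Real.exp (-(l : ℝ)) := by
  change T.rho T' ≤ _
  by_cases hne : T = T'
  · rw [hne, RootedTree.rho_self]
    positivity
  · rw [RootedTree.rho, if_neg hne, Real.exp_le_exp, neg_le_neg_iff, Nat.cast_le]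
    exact le_csSup (RootedTree.bddAbove_of_ne hne) h

theorem continuous_treeConv :
    Continuous fun p : RootedTree N × (Fin N → ProbabilityMeasure ℝ) => treeConv p.1 p.2 := by
  refine SeqContinuous.continuous fun p p₀ hp => ?_
  obtain ⟨T, μ⟩ := p₀
  have hT : Tendsto (fun n => (p n).1) atTop (𝓝 T) := (continuous_fst.tendsto _).comp hp
  have hμ : Tendsto (fun n => (p n).2) atTop (𝓝 μ) := (continuous_snd.tendsto _).comp hp
  obtain ⟨y₀, hy₀, h0, -⟩ := exists_totalMoment_lt μ one_pos
  refine tendsto_of_tendsto_cauchyTransform hy₀ fun y hy => ?_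
  have hy' := hy₀.trans_le hy
  have him := mul_I_im_pos hy'
  have hgood : 136 * totalMoment μ y < 1 / 2 := by linarith [totalMoment_antitone μ hy₀ hy]
  -- The strict smallness condition is open in the measures, so the same `y` and the same geometric
  -- rate serve for all large `n`.
  have hgood' : ∀ᶠ n in atTop, 136 * totalMoment (p n).2 y < 1 / 2 :=
    ((((continuous_totalMoment hy').tendsto μ).comp hμ).const_mul 136).eventually
      (gt_mem_nhds hgood)
  refine tendsto_cauchyTransform_of_kTransform him (Metric.tendsto_nhds.2 fun ε hε => ?_)
  have hpow : Tendsto (fun l : ℕ => 2 * y * (1 / 2 : ℝ) ^ l) atTop (𝓝 0) := by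
    simpa using (tendsto_pow_atTop_nhds_zero_of_lt_one (by norm_num : (0 : ℝ) ≤ 1 / 2)
      (by norm_num)).const_mul (2 * y)
  obtain ⟨l, hl⟩ := (hpow.eventually (gt_mem_nhds (show (0 : ℝ) < ε / 3 by positivity))).exists
  have hball : ∀ᶠ n in atTop, (p n).1.ball l = T.ball l :=
    (Metric.tendsto_nhds.1 hT _ (Real.exp_pos (-(l : ℝ)))).mono fun n hn => ball_eq_of_dist_lt hn
  filter_upwards [hgood', hball, Metric.tendsto_nhds.1
    (tendsto_kTransform_truncConv_right hμ l T him) (ε / 3) (by positivity)] with n h1 h2 h3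
  have h4 := dist_kTransform_truncConv_treeConv_le hy' h1.le (p n).1 l
  have h5 := dist_kTransform_truncConv_treeConv_le hy' hgood.le T l
  rw [truncConv_eq_of_ball_eq _ h2, dist_comm] at h4
  have h6 := dist_triangle4 (kTransform (treeConv (p n).1 (p n).2) (y * I))
    (kTransform (truncConv l T (p n).2) (y * I)) (kTransform (truncConv l T μ) (y * I))
    (kTransform (treeConv T μ) (y * I))
  exact h6.trans_lt (by linarith)

/-! ### Uniqueness -/

/-- The truncation of a rooted tree at height `l`. -/
def RootedTree.truncate (T : RootedTree N) (l : ℕ) : RootedTree N where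
  verts := T.ball l
  root_mem := ⟨T.root_mem, Nat.zero_le l⟩
  connected := connected_of_parent ⟨T.root_mem, Nat.zero_le l⟩ fun j s t ht hts =>
    ⟨T.parent_mem j s t ht.1 hts, by
      have := ht.2
      rw [hts, List.length_cons] at this
      omega⟩

lemma RootedTree.tendsto_truncate (T : RootedTree N) : Tendsto T.truncate atTop (𝓝 T) := by
  refine tendsto_iff_dist_tendsto_zero.2 (squeeze_zero (fun _ => dist_nonneg)
    (fun l => dist_le_of_ball_eq (l := l) ?_)
    (Real.tendsto_exp_neg_atTop_nhds_zero.comp tendsto_natCast_atTop_atTop))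
  ext s
  exact ⟨fun h => h.1, fun h => ⟨h, h.2⟩⟩

/-- Each string `s` of a branch comes from the longer string `sj` of the tree, so branches have
height one less. At height zero the sum is empty and `K = 0`. -/
lemma SatisfiesFixedPointEquation.eq_of_bounded
    {C C' : RootedTree N → (Fin N → ProbabilityMeasure ℝ) → ProbabilityMeasure ℝ}
    (hC : SatisfiesFixedPointEquation C) (hC' : SatisfiesFixedPointEquation C')
    (μ : Fin N → ProbabilityMeasure ℝ) {l : ℕ} {T : RootedTree N}
    (hT : ∀ s ∈ T.verts, s.1.length ≤ l) : C T μ = C' T μ := by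
  classical
  induction l generalizing T with
  | zero =>
    have hempty : IsEmpty {j : Fin N // AltString.letter j ∈ T.verts} :=
      ⟨fun j => by simpa [AltString.letter] using hT _ j.2⟩
    refine eq_of_kTransform_eq fun z hz => ?_
    rw [hC T μ z hz, hC' T μ z hz]
    exact (Finset.sum_of_isEmpty _).trans (Finset.sum_of_isEmpty _).symm
  | succ l ih =>
    refine eq_of_kTransform_eq fun z hz => ?_
    rw [hC T μ z hz, hC' T μ z hz]
    refine Finset.sum_congr rfl fun j _ => ?_
    rw [ih (T := T.branch j.1 j.2)]
    rintro s ⟨t, ht, hts⟩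
    have := hT t ht
    rw [hts, List.length_append, List.length_singleton] at this
    omega

theorem SatisfiesFixedPointEquation.unique
    {C C' : RootedTree N → (Fin N → ProbabilityMeasure ℝ) → ProbabilityMeasure ℝ}
    (hC : SatisfiesFixedPointEquation C) (hC' : SatisfiesFixedPointEquation C')
    (hcont : ∀ μ, Continuous fun T => C T μ) (hcont' : ∀ μ, Continuous fun T => C' T μ) :
    C = C' := by
  funext T μ
  have h1 := ((hcont μ).tendsto T).comp T.tendsto_truncate
  have h2 := ((hcont' μ).tendsto T).comp T.tendsto_truncate
  refine tendsto_nhds_unique h1 (h2.congr fun l => ?_)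
  exact (hC.eq_of_bounded hC' μ (T := T.truncate l) (l := l) fun s hs => hs.2).symm

end TreeConvolution

theorem theorem4p1 (N : ℕ) :
    (∃! C : TreeConvolution.RootedTree N → (Fin N → MeasureTheory.ProbabilityMeasure ℝ) →
        MeasureTheory.ProbabilityMeasure ℝ,
      (∀ μ : Fin N → MeasureTheory.ProbabilityMeasure ℝ, Continuous (fun T => C T μ)) ∧
      TreeConvolution.SatisfiesFixedPointEquation C) ∧
    (∀ C : TreeConvolution.RootedTree N → (Fin N → MeasureTheory.ProbabilityMeasure ℝ) →
        MeasureTheory.ProbabilityMeasure ℝ,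
      (∀ μ : Fin N → MeasureTheory.ProbabilityMeasure ℝ, Continuous (fun T => C T μ)) →
      TreeConvolution.SatisfiesFixedPointEquation C →
      Continuous (fun p : TreeConvolution.RootedTree N ×
        (Fin N → MeasureTheory.ProbabilityMeasure ℝ) => C p.1 p.2)) := by
  have hcont : ∀ μ : Fin N → ProbabilityMeasure ℝ,
      Continuous fun T : TreeConvolution.RootedTree N => TreeConvolution.treeConv T μ := fun μ =>
    TreeConvolution.continuous_treeConv.comp (Continuous.prodMk_left μ)
  have heq := TreeConvolution.satisfiesFixedPointEquation_treeConv (N := N)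
  refine ⟨⟨TreeConvolution.treeConv, ⟨hcont, heq⟩, fun C hC => hC.2.unique heq hC.1 hcont⟩,
    fun C hC hC' => ?_⟩
  -- Uniqueness identifies any solution with `treeConv`, whose joint continuity is known.
  rw [hC'.unique heq hC hcont]
  exact TreeConvolution.continuous_treeConv
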